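/- Let $(M,g)$ be a smooth $4$-dimensional pseudo-Riemannian manifold of signature $(2,2)$, with Riemann curvature tensor $R$ (sign convention $R(x,y)=\nabla_{[x,y]}-[\nabla_x,\nabla_y]$, $R(x,y,z,v)=g(R(x,y)z,v)$) and Weyl curvature tensor $W$. For $A\in\{R,W\}$ and a tangent vector $x\in T_pM$, let $J_A(x):T_pM\to T_pM$ be the linear operator determined by $g(J_A(x)y,z)=A(y,x,x,z)$. A frame $\{e_1,e_2,e_3,e_4\}$ is called pseudo-orthonormal if $g(e_i,e_j)=\epsilon_i\delta_{ij}$ with $\epsilon_1=\epsilon_2=-1$, $\epsilon_3=\epsilon_4=1$. The manifold is called globally Jordan Osserman (resp. globally conformally Jordan Osserman) if the Jordan normal form of $J_R(x)$ (resp. $J_W(x)$) is the same for all tangent vectors $x$ with $g(x,x)=-1$ at all points of $M$. If $(M,g)$ is globally Jordan Osserman (resp. globally conformally Jordan Osserman), then every point $P\in M$ has an open neighbourhood $U$ with a smooth pseudo-orthonormal frame $\{e_1,e_2,e_3,e_4\}$ on $U$ and a constant real $3\times 3$ matrix $L$ such that at every point of $U$ the matrix, with respect to $\{e_2,e_3,e_4\}$,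 of the operator $J_R(e_1)$ (resp. $J_W(e_1)$) on $\{e_1\}^{\perp}$ equals $L$ (columns are the coordinates of the images of $e_2,e_3,e_4$), and $L$ is of one of the following four types: $$\text{I: }\begin{bmatrix}\alpha&0&0\\0&\beta&0\\0&0&\gamma\end{bmatrix},\qquad \text{II: }\begin{bmatrix}\alpha&\beta&0\\-\beta&\alpha&0\\0&0&\gamma\end{bmatrix}\ (\beta\neq0),$$ $$\text{III: }\begin{bmatrix}\epsilon(\alpha-\tfrac12)&\epsilon\tfrac12&0\\-\epsilon\tfrac12&\epsilon(\alpha+\tfrac12)&0\\0&0&\beta\end{bmatrix}\ (\epsilon=\pm1),\qquad \text{IV: }\begin{bmatrix}\alpha&0&\tfrac{\sqrt2}{2}\\0&\alpha&\tfrac{\sqrt2}{2}\\-\tfrac{\sqrt2}{2}&\tfrac{\sqrt2}{2}&\alpha\end{bmatrix},$$ with $\alpha,\beta,\gamma\in\mathbb R$. -/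

import Mathlib

open scoped Manifold ContDiff Matrix Topology

set_option maxSynthPendingDepth 3

noncomputable section

/-! ### Linear algebra: tensors on a vector space with a nondegenerate symmetric form -/

section Algebra

variable {V : Type*} [AddCommGroup V] [Module ℝ V] [FiniteDimensional ℝ V]

/-- The signs of a pseudo-orthonormal basis `e₁, e₂, e₃, e₄` (indexed by `0, 1, 2, 3`):
the first two vectors are timelike, the last two are spacelike. -/
def neutralSign : Fin 4 → ℝ := ![-1, -1, 1, 1]

/-- `g (eᵢ, eⱼ) = εᵢ δᵢⱼ` with `ε = (-1, -1, 1, 1)`. -/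
def IsPseudoOrthonormal (g : LinearMap.BilinForm ℝ V) (e : Fin 4 → V) : Prop :=
  ∀ i j, g (e i) (e j) = if i = j then neutralSign i else 0

/-- Covariant `4`-tensors. -/
abbrev FourTensor (V : Type*) [AddCommGroup V] [Module ℝ V] : Type _ :=
  V →ₗ[ℝ] V →ₗ[ℝ] V →ₗ[ℝ] V →ₗ[ℝ] ℝ

/-- The pull-back of a `4`-tensor under a linear map. -/
def FourTensor.pullback {V V' : Type*} [AddCommGroup V] [Module ℝ V] [AddCommGroup V']
    [Module ℝ V'] (A : FourTensor V') (T : V →ₗ[ℝ] V') : FourTensor V :=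
  LinearMap.mk₂ ℝ
    (fun x y => (A (T x) (T y)).compl₁₂ T T)
    (by intros; ext; simp) (by intros; ext; simp) (by intros; ext; simp) (by intros; ext; simp)

/-- The Jacobi operator `J_A(x)` of a `4`-tensor `A`, determined by
`g (J_A(x) y, z) = A (y, x, x, z)`. -/
def jacobiOperator (g : LinearMap.BilinForm ℝ V) (hg : g.Nondegenerate) (A : FourTensor V)
    (x : V) : V →ₗ[ℝ] V :=
  (g.toDual hg).symm.toLinearMap ∘ₗ ((A.flip x).flip x)

theorem jacobiOperator_spec (g : LinearMap.BilinForm ℝ V) (hg : g.Nondegenerate)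
    (A : FourTensor V) (x y z : V) : g (jacobiOperator g hg A x y) z = A y x x z := by
  simp [jacobiOperator]

/-- The contraction `g^{ab} h_{ab}` of a bilinear form `h` with the metric `g`. -/
def metricContraction (g : LinearMap.BilinForm ℝ V) (hg : g.Nondegenerate)
    (h : LinearMap.BilinForm ℝ V) : ℝ :=
  LinearMap.trace ℝ V ((g.toDual hg).symm.toLinearMap ∘ₗ h)

/-- The bilinear form `(x, z) ↦ A (x, y, z, v)`. -/
def slotsOneThree (A : FourTensor V) (y v : V) : LinearMap.BilinForm ℝ V :=
  LinearMap.mk₂ ℝ (fun x z => A x y z v) (by simp) (by simp) (by simp) (by simp)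

/-- The Ricci tensor: the contraction of `A` in the first and the third slots. -/
def ricciTensor (g : LinearMap.BilinForm ℝ V) (hg : g.Nondegenerate) (A : FourTensor V) :
    LinearMap.BilinForm ℝ V :=
  have hl : ∀ y y' v, slotsOneThree A (y + y') v = slotsOneThree A y v + slotsOneThree A y' v := by
    intros; ext; simp [slotsOneThree]
  have hls : ∀ (c : ℝ) y v, slotsOneThree A (c • y) v = c • slotsOneThree A y v := by
    intros; ext; simp [slotsOneThree]
  have hr : ∀ y v v', slotsOneThree A y (v + v') = slotsOneThree A y v + slotsOneThree A y v' := by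
    intros; ext; simp [slotsOneThree]
  have hrs : ∀ (c : ℝ) y v, slotsOneThree A y (c • v) = c • slotsOneThree A y v := by
    intros; ext; simp [slotsOneThree]
  LinearMap.mk₂ ℝ (fun y v => metricContraction g hg (slotsOneThree A y v))
    (by simp [metricContraction, hl, LinearMap.comp_add])
    (by simp [metricContraction, hls, LinearMap.comp_smul])
    (by simp [metricContraction, hr, LinearMap.comp_add])
    (by simp [metricContraction, hrs, LinearMap.comp_smul])

/-- The scalar curvature: the contraction of the Ricci tensor. -/
def scalarCurvature (g : LinearMap.BilinForm ℝ V) (hg : g.Nondegenerate) (A : FourTensor V) : ℝ :=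
  metricContraction g hg (ricciTensor g hg A)

/-- The Kulkarni–Nomizu product of two bilinear forms. -/
def kulkarniNomizu (h k : LinearMap.BilinForm ℝ V) : FourTensor V :=
  LinearMap.mk₂ ℝ
    (fun v₁ v₂ => LinearMap.mk₂ ℝ
      (fun v₃ v₄ => h v₁ v₃ * k v₂ v₄ + h v₂ v₄ * k v₁ v₃ - h v₁ v₄ * k v₂ v₃ - h v₂ v₃ * k v₁ v₄)
      (by intros; simp; ring) (by intros; simp; ring) (by intros; simp; ring)
      (by intros; simp; ring))
    (by intros; ext; simp; ring) (by intros; ext; simp; ring) (by intros; ext; simp; ring)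
    (by intros; ext; simp; ring)

/-- The Weyl tensor `W` of a curvature tensor `A` in dimension four:
`A = (Scal / 24) g · g + (1 / 2) (Ric - (Scal / 4) g) · g + W`. -/
def weylTensor (g : LinearMap.BilinForm ℝ V) (hg : g.Nondegenerate) (A : FourTensor V) :
    FourTensor V :=
  A - (scalarCurvature g hg A / 24) • kulkarniNomizu g g
    - (1 / 2 : ℝ) • kulkarniNomizu (ricciTensor g hg A - (scalarCurvature g hg A / 4) • g) g

/-- Complex Jordan matrices (block diagonal with Jordan blocks on the diagonal): arbitrary
diagonal, superdiagonal entries `0` or `1`, a `1` only between equal diagonal entries, and zeros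
elsewhere. -/
def IsJordanMatrix {n : ℕ} (N : Matrix (Fin n) (Fin n) ℂ) : Prop :=
  ∀ i j, i ≠ j → N i j = 0 ∨ ((i : ℕ) + 1 = j ∧ N i j = 1 ∧ N i i = N j j)

/-- `N` is a Jordan normal form of the endomorphism `T` of the real four-dimensional space `V`:
`N` is a Jordan matrix and the (complexified) matrix of `T` in some real basis is similar to `N`. -/
def HasJordanNormalForm (T : V →ₗ[ℝ] V) (N : Matrix (Fin 4) (Fin 4) ℂ) : Prop :=
  IsJordanMatrix N ∧ ∃ (b : Module.Basis (Fin 4) ℝ V) (P : Matrix (Fin 4) (Fin 4) ℂ),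
    IsUnit P ∧ (LinearMap.toMatrix b b T).map (algebraMap ℝ ℂ) * P = P * N

end Algebra

/-! ### The four normal forms -/

/-- Type I. -/
def typeI (α β γ : ℝ) : Matrix (Fin 3) (Fin 3) ℝ :=
  !![α, 0, 0; 0, β, 0; 0, 0, γ]

/-- Type II (used with `β ≠ 0`). -/
def typeII (α β γ : ℝ) : Matrix (Fin 3) (Fin 3) ℝ :=
  !![α, β, 0; -β, α, 0; 0, 0, γ]

/-- Type III (used with `ε = ±1`). -/
def typeIII (ε α β : ℝ) : Matrix (Fin 3) (Fin 3) ℝ :=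
  !![ε * (α - 1 / 2), ε * (1 / 2), 0; -ε * (1 / 2), ε * (α + 1 / 2), 0; 0, 0, β]

/-- Type IV. -/
def typeIV (α : ℝ) : Matrix (Fin 3) (Fin 3) ℝ :=
  !![α, 0, √2 / 2; 0, α, √2 / 2; -(√2 / 2), √2 / 2, α]

/-- `L` is one of the four normal forms. -/
def IsNormalForm (L : Matrix (Fin 3) (Fin 3) ℝ) : Prop :=
  (∃ α β γ : ℝ, L = typeI α β γ) ∨
  (∃ α β γ : ℝ, β ≠ 0 ∧ L = typeII α β γ) ∨
  (∃ ε α β : ℝ, (ε = 1 ∨ ε = -1) ∧ L = typeIII ε α β) ∨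
  (∃ α : ℝ, L = typeIV α)

/-! ### Levi-Civita connection and curvature of a metric on an open set of a vector space -/

section Coordinates

variable {E : Type*} [NormedAddCommGroup E] [NormedSpace ℝ E]

/-- Christoffel symbols of the first kind (as a map `v ↦ w ↦ z ↦ Γ(v, w; z)`):
`Γ(v, w; z) = ½ (∂ᵥ G(w, z) + ∂_w G(v, z) - ∂_z G(v, w))`. -/
def christoffelFirst (G : E → E →L[ℝ] E →L[ℝ] ℝ) (u : E) : E →L[ℝ] E →L[ℝ] E →L[ℝ] ℝ :=
  (1 / 2 : ℝ) • (fderiv ℝ G u + (fderiv ℝ G u).flip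
    - (ContinuousLinearMap.flipₗᵢ ℝ E E ℝ).toContinuousLinearEquiv.toContinuousLinearMap ∘L
        (fderiv ℝ G u).flip)

theorem christoffelFirst_apply (G : E → E →L[ℝ] E →L[ℝ] ℝ) (u v w z : E) :
    christoffelFirst G u v w z =
      1 / 2 * (fderiv ℝ G u v w z + fderiv ℝ G u w v z - fderiv ℝ G u z v w) := by
  simp [christoffelFirst]

/-- Christoffel symbols of the second kind, `Γ(v, w) = ∇ᵥ w` for constant fields `v`, `w`; they are
determined by `G (Γ(v, w), z) = Γ(v, w; z)` where `G` is nondegenerate. -/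
def christoffel (G : E → E →L[ℝ] E →L[ℝ] ℝ) (u : E) : E →L[ℝ] E →L[ℝ] E :=
  (ContinuousLinearMap.compL ℝ E (E →L[ℝ] ℝ) E (G u).inverse) ∘L christoffelFirst G u

/-- The curvature operator `R(x, y) = ∇_[x,y] - [∇ₓ, ∇_y]` of the Levi-Civita connection of `G`,
evaluated on constant fields:
`R(x, y) z = (∂_y Γ)(x, z) - (∂ₓ Γ)(y, z) + Γ(y, Γ(x, z)) - Γ(x, Γ(y, z))`.
With this sign the round sphere has `R(x, y) z = g(x, z) y - g(y, z) x`. -/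
def coordCurvature (G : E → E →L[ℝ] E →L[ℝ] ℝ) (u x y : E) : E →L[ℝ] E :=
  fderiv ℝ (christoffel G) u y x - fderiv ℝ (christoffel G) u x y
    + christoffel G u y ∘L christoffel G u x - christoffel G u x ∘L christoffel G u y

/-- The covariant curvature tensor `R(x, y, z, v) = G (R(x, y) z, v)`. -/
def coordRiemann (G : E → E →L[ℝ] E →L[ℝ] ℝ) (u : E) : FourTensor E :=
  LinearMap.mk₂ ℝ
    (fun x y => LinearMap.mk₂ ℝ (fun z v => G u (coordCurvature G u x y z) v)
      (by intros; simp) (by intros; simp) (by intros; simp) (by intros; simp))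
    (by intros; ext; simp [coordCurvature]; ring) (by intros; ext; simp [coordCurvature]; ring)
    (by intros; ext; simp [coordCurvature]; ring) (by intros; ext; simp [coordCurvature]; ring)

end Coordinates

/-! ### Pseudo-Riemannian four-manifolds -/

/-- The model space. -/
abbrev E4 : Type := EuclideanSpace ℝ (Fin 4)

section Manifolds

instance {M : Type*} [TopologicalSpace M] [ChartedSpace E4 M] (p : M) :
    FiniteDimensional ℝ (TangentSpace 𝓘(ℝ, E4) p) :=
  inferInstanceAs (FiniteDimensional ℝ E4)

variable (M : Type*) [TopologicalSpace M] [ChartedSpace E4 M] [IsManifold 𝓘(ℝ, E4) ∞ M]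

/-- A smooth pseudo-Riemannian metric on the four-manifold `M`. -/
structure PseudoRiemannianMetric where
  val (p : M) : TangentSpace 𝓘(ℝ, E4) p →L[ℝ] TangentSpace 𝓘(ℝ, E4) p →L[ℝ] ℝ
  symm (p : M) (v w : TangentSpace 𝓘(ℝ, E4) p) : val p v w = val p w v
  nondegenerate (p : M) (v : TangentSpace 𝓘(ℝ, E4) p) : (∀ w, val p v w = 0) → v = 0
  contMDiff : ContMDiff 𝓘(ℝ, E4) (𝓘(ℝ, E4).prod 𝓘(ℝ, E4 →L[ℝ] E4 →L[ℝ] ℝ)) ∞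
    (fun p => Bundle.TotalSpace.mk' (E4 →L[ℝ] E4 →L[ℝ] ℝ)
      (E := fun p : M => TangentSpace 𝓘(ℝ, E4) p →L[ℝ] TangentSpace 𝓘(ℝ, E4) p →L[ℝ] ℝ)
      p (val p))

namespace PseudoRiemannianMetric

variable {M} (g : PseudoRiemannianMetric M)

/-- The metric on `T_p M`, as a bilinear form. -/
def form (p : M) : LinearMap.BilinForm ℝ (TangentSpace 𝓘(ℝ, E4) p) :=
  LinearMap.mk₂ ℝ (fun v w => g.val p v w) (by simp) (by simp) (by simp) (by simp)

theorem form_nondegenerate (p : M) : (g.form p).Nondegenerate := by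
  refine ⟨fun v h => g.nondegenerate p v h, fun v h => g.nondegenerate p v fun w => ?_⟩
  rw [g.symm]
  exact h w

/-- The metric has signature `(2, 2)`: every tangent space has a pseudo-orthonormal basis. -/
def IsNeutral : Prop :=
  ∀ p : M, ∃ b : Module.Basis (Fin 4) ℝ (TangentSpace 𝓘(ℝ, E4) p),
    IsPseudoOrthonormal (g.form p) b

/-- The metric in the chart `φ`: the pull-back of `g` under `φ⁻¹`. -/
def inChart (φ : OpenPartialHomeomorph M E4) (u : E4) : E4 →L[ℝ] E4 →L[ℝ] ℝ :=
  let D : E4 →L[ℝ] E4 := mfderiv 𝓘(ℝ, E4) 𝓘(ℝ, E4) φ.symm u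
  let B : E4 →L[ℝ] E4 →L[ℝ] ℝ := g.val (φ.symm u)
  B.bilinearComp D D

/-- The Riemann curvature tensor of `g` on `T_p M`: the pull-back, under the differential at `p` of
the preferred chart `φ` at `p`, of the curvature tensor of the metric expressed in `φ`. -/
def riemannTensor (p : M) : FourTensor (TangentSpace 𝓘(ℝ, E4) p) :=
  let φ := chartAt E4 p
  let D : TangentSpace 𝓘(ℝ, E4) p →L[ℝ] E4 := mfderiv 𝓘(ℝ, E4) 𝓘(ℝ, E4) φ p
  (coordRiemann (g.inChart φ) (φ p)).pullback D.toLinearMap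

/-- The Jacobi operator `J_R(x)`. -/
def jacobi (p : M) (x : TangentSpace 𝓘(ℝ, E4) p) :
    TangentSpace 𝓘(ℝ, E4) p →ₗ[ℝ] TangentSpace 𝓘(ℝ, E4) p :=
  jacobiOperator (g.form p) (g.form_nondegenerate p) (g.riemannTensor p) x

/-- The conformal Jacobi operator `J_W(x)`. -/
def conformalJacobi (p : M) (x : TangentSpace 𝓘(ℝ, E4) p) :
    TangentSpace 𝓘(ℝ, E4) p →ₗ[ℝ] TangentSpace 𝓘(ℝ, E4) p :=
  jacobiOperator (g.form p) (g.form_nondegenerate p)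
    (weylTensor (g.form p) (g.form_nondegenerate p) (g.riemannTensor p)) x

/-- The Jordan normal form of the Jacobi operator `J_R(x)` is independent of the unit timelike
vector `x` and of its base point. -/
def IsGloballyJordanOsserman : Prop :=
  ∃ N : Matrix (Fin 4) (Fin 4) ℂ, ∀ (p : M) (x : TangentSpace 𝓘(ℝ, E4) p),
    g.form p x x = -1 → HasJordanNormalForm (g.jacobi p x) N

/-- The Jordan normal form of the conformal Jacobi operator `J_W(x)` is independent of the unit
timelike vector `x` and of its base point. -/
def IsGloballyConformallyJordanOsserman : Prop :=
  ∃ N : Matrix (Fin 4) (Fin 4) ℂ, ∀ (p : M) (x : TangentSpace 𝓘(ℝ, E4) p),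
    g.form p x x = -1 → HasJordanNormalForm (g.conformalJacobi p x) N

/-- `e` is a smooth pseudo-orthonormal frame on `U`. -/
def IsSmoothFrameOn (e : Fin 4 → ∀ p : M, TangentSpace 𝓘(ℝ, E4) p) (U : Set M) : Prop :=
  (∀ i, ContMDiffOn 𝓘(ℝ, E4) 𝓘(ℝ, E4).tangent ∞
    (fun p => (⟨p, e i p⟩ : TangentBundle 𝓘(ℝ, E4) M)) U) ∧
  ∀ p ∈ U, IsPseudoOrthonormal (g.form p) (fun i => e i p)

end PseudoRiemannianMetric

/-- `L` is the matrix, with respect to `{e₂, e₃, e₄}`, of the endomorphism that `T` induces on the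
span of `e₂, e₃, e₄` (the `j`-th column holds the coordinates of the image of the `j`-th vector). -/
def IsMatrixOnLastThree {V : Type*} [AddCommGroup V] [Module ℝ V] (T : V →ₗ[ℝ] V) (e : Fin 4 → V)
    (L : Matrix (Fin 3) (Fin 3) ℝ) : Prop :=
  ∀ j : Fin 3, T (e j.succ) = ∑ i : Fin 3, L i j • e i.succ

end Manifolds

end

/-! Both halves are one statement about a smooth tensor field with the pair symmetries of a
curvature tensor. For such a tensor the Jacobi operator of a unit timelike `e₁` kills `e₁` and is
self-adjoint, so in a pseudo-orthonormal frame its matrix is a 3 × 3 block, self-adjoint for the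
form of signature (-,+,+), bordered by zeros. The proof combines pointwise algebra with a smooth
dependence argument.

Pointwise (`exists_normalForm`): the block has a real eigenvector, because its characteristic
polynomial is a cubic. If the eigenvector is timelike, the complement is definite and the block is
diagonalisable. If it is spacelike, a Lorentzian plane remains, where a boost gives type I, II or
III. A null eigenvector either leads to a spacelike one or forces type IV.

Smoothly: a common Jordan form makes all Jacobi matrices similar over ℂ, hence over ℝ
(`exists_real_intertwiner`). Similarity alone does not give a Lorentz transformation: it sees
neither the sign in type III nor which eigenvector is timelike in type I. Closeness to a fixed
matrix `J₀` repairs this. The equation `J X = X J₀` has a solution space of constant dimension along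
a similarity class, so the solution `1` at `J₀` continues to a smooth solution `D` near `1`
(`exists_smooth_intertwiner`). The factor `K = η Dᵀ η D` of its polar decomposition is self-adjoint
and commutes with the reference block, and so does `K^(-1/2)`; thus `D K^(-1/2)` is an isometric
intertwiner (`exists_smooth_isometric_intertwiner`). Composed with the constant transformation that
normalises the block at the base point, it brings all nearby blocks to the same normal form.

The geometric input is that the curvature has the required symmetries
(`IsSmoothMetricAt.isCurvatureLike_coordRiemann`) and is smooth. The tensor at `p` is defined in the
preferred chart at `p`, which may jump with `p`; naturality under changes of charts
(`IsMetricPullbackAt.coordRiemann_eq`) allows one fixed chart to be used. -/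

noncomputable section

/-! ### Smooth solutions of linear and quadratic matrix equations -/

section MatrixEquations

open scoped Matrix.Norms.Operator

/-- A linear map has a generalized inverse. -/
theorem LinearMap.exists_generalizedInverse {V W : Type*} [AddCommGroup V] [Module ℝ V]
    [AddCommGroup W] [Module ℝ W] (Φ : V →ₗ[ℝ] W) :
    ∃ B : W →ₗ[ℝ] V, Φ ∘ₗ B ∘ₗ Φ = Φ ∧ B ∘ₗ Φ ∘ₗ B = B := by
  obtain ⟨C, hC⟩ := Φ.rangeRestrict.exists_rightInverse_of_surjective Φ.range_rangeRestrict
  obtain ⟨π, hπ⟩ := (Φ.range.subtype).exists_leftInverse_of_injective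
    (LinearMap.ker_eq_bot.2 Subtype.val_injective)
  have h1 : ∀ y : Φ.range, Φ (C y) = y := fun y => congrArg Subtype.val (LinearMap.congr_fun hC y)
  have h2 : ∀ x, π (Φ x) = Φ.rangeRestrict x := fun x => LinearMap.congr_fun hπ (Φ.rangeRestrict x)
  refine ⟨C ∘ₗ π, ?_, ?_⟩
  · ext x; simp [h2, h1]
  · ext x
    have : Φ.rangeRestrict (C (π x)) = π x := LinearMap.congr_fun hC _
    simp [h2, this]

/-- Vectors in the kernel of a linear map extend smoothly to kernels of nearby maps whose rank is
not larger. -/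
theorem exists_smooth_kernel_section {V W : Type*} [NormedAddCommGroup V] [NormedSpace ℝ V]
    [FiniteDimensional ℝ V] [NormedAddCommGroup W] [NormedSpace ℝ W] [FiniteDimensional ℝ W]
    (Φ₀ : V →L[ℝ] W) (v₀ : V) (hv₀ : Φ₀ v₀ = 0) :
    ∃ F : (V →L[ℝ] W) → V, F Φ₀ = v₀ ∧ ∀ᶠ Φ in 𝓝 Φ₀, ContDiffAt ℝ ∞ F Φ ∧
      (Module.finrank ℝ Φ.range ≤ Module.finrank ℝ Φ₀.range → Φ (F Φ) = 0) := by
  obtain ⟨B', hB1, hB2⟩ := (Φ₀ : V →ₗ[ℝ] W).exists_generalizedInverse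
  set B : W →L[ℝ] V := LinearMap.toContinuousLinearMap B' with hB
  have hB1' : ∀ x, Φ₀ (B (Φ₀ x)) = Φ₀ x := fun x => LinearMap.congr_fun hB1 x
  have hB2' : ∀ y, B (Φ₀ (B y)) = B y := fun y => LinearMap.congr_fun hB2 y
  -- Newton-type correction: `m Φ₀ = 1`, and `v = (m Φ)⁻¹ v₀` satisfies `B (Φ v) = 0`. It then
  -- remains to remove `B`.
  let m : (V →L[ℝ] W) → (V →L[ℝ] V) := fun Φ => 1 + B ∘L (Φ - Φ₀)
  have hm : ContDiff ℝ ∞ m := by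
    have : ContDiff ℝ ∞ fun Φ : V →L[ℝ] W => Φ - Φ₀ := by fun_prop
    exact contDiff_const.add (contDiff_const.clm_comp this)
  have hm0 : m Φ₀ = 1 := by simp [m]
  refine ⟨fun Φ => Ring.inverse (m Φ) v₀, by simp [hm0], ?_⟩
  have hu : ∀ᶠ Φ in 𝓝 Φ₀, IsUnit (m Φ) := by
    apply hm.continuous.continuousAt.eventually
    rw [hm0]
    exact Units.isOpen.mem_nhds isUnit_one
  filter_upwards [hu] with Φ hΦ
  constructor
  · obtain ⟨w, hw⟩ := hΦ
    have h1 : ContDiffAt ℝ ∞ Ring.inverse (m Φ) := hw ▸ contDiffAt_ringInverse ℝ w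
    exact (h1.comp Φ hm.contDiffAt).clm_apply contDiffAt_const
  · intro hr
    set v := Ring.inverse (m Φ) v₀
    have e1 : m Φ v = v₀ := by
      have := Ring.mul_inverse_cancel _ hΦ
      exact congrArg (fun f : V →L[ℝ] V => f v₀) this
    have e2 : v + (B (Φ v) - B (Φ₀ v)) = v₀ := by simpa [m] using e1
    have e3 : Φ₀ (B (Φ v)) = 0 := by
      have := congrArg Φ₀ e2
      simpa [hB1', hv₀] using this
    have e4 : B (Φ v) = 0 := by rw [← hB2', e3, map_zero]
    -- `B` is injective on the range of `Φ`
    let Bl : V →ₗ[ℝ] V := (B : W →ₗ[ℝ] V) ∘ₗ (Φ : V →ₗ[ℝ] W)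
    let Pl : V →ₗ[ℝ] V := LinearMap.id - (B : W →ₗ[ℝ] V) ∘ₗ (Φ₀ : V →ₗ[ℝ] W)
    -- Since `m Φ = B Φ + (1 - B Φ₀)` is onto and `1 - B Φ₀` maps into the kernel of `Φ₀`, the rank
    -- of `B Φ` is at least that of `Φ₀`, hence at least that of `Φ`.
    have hsum : (⊤ : Submodule ℝ V) ≤ Bl.range ⊔ Pl.range := by
      intro x _
      have hx : m Φ (Ring.inverse (m Φ) x) = x := by
        have := Ring.mul_inverse_cancel _ hΦ
        exact congrArg (fun f : V →L[ℝ] V => f x) this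
      rw [← hx, Submodule.mem_sup]
      refine ⟨Bl (Ring.inverse (m Φ) x), ⟨_, rfl⟩, Pl (Ring.inverse (m Φ) x), ⟨_, rfl⟩, ?_⟩
      simp [Bl, Pl, m]; abel
    have d1 : Module.finrank ℝ V ≤ Module.finrank ℝ Bl.range + Module.finrank ℝ Pl.range := by
      have h1 := Submodule.finrank_add_le_finrank_add_finrank Bl.range Pl.range
      have h2 := Submodule.finrank_mono hsum
      rw [finrank_top] at h2
      omega
    have d2 : Module.finrank ℝ Pl.range ≤ Module.finrank ℝ Φ₀.ker := by
      apply Submodule.finrank_mono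
      rintro _ ⟨x, rfl⟩
      simp [Pl, hB1']
    have d3 : Module.finrank ℝ Φ₀.range + Module.finrank ℝ Φ₀.ker = Module.finrank ℝ V :=
      (Φ₀ : V →ₗ[ℝ] W).finrank_range_add_finrank_ker
    let r : Φ.range →ₗ[ℝ] V := (B : W →ₗ[ℝ] V) ∘ₗ Φ.range.subtype
    have d4 : Module.finrank ℝ r.range + Module.finrank ℝ r.ker = Module.finrank ℝ Φ.range :=
      r.finrank_range_add_finrank_ker
    have d5 : Module.finrank ℝ Bl.range ≤ Module.finrank ℝ r.range := by
      apply Submodule.finrank_mono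
      rintro _ ⟨x, rfl⟩
      exact ⟨⟨Φ x, x, rfl⟩, rfl⟩
    have d6 : Module.finrank ℝ r.ker = 0 := by omega
    have d7 : r.ker = ⊥ := Submodule.finrank_eq_zero.1 d6
    have d8 : (⟨Φ v, v, rfl⟩ : Φ.range) ∈ r.ker := e4
    rw [d7, Submodule.mem_bot] at d8
    exact congrArg Subtype.val d8

variable {n : Type*} [Fintype n] [DecidableEq n]

/-- Matrices near `1` that are self-adjoint with respect to `η` and commute with `L` have an
inverse square root with the same properties, depending smoothly on the matrix. -/
theorem exists_smooth_inverse_sqrt (η L : Matrix n n ℝ) :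
    ∃ s : Matrix n n ℝ → Matrix n n ℝ, s 1 = 1 ∧ ∀ᶠ K in 𝓝 (1 : Matrix n n ℝ), ContDiffAt ℝ ∞ s K ∧
      (Kᵀ * η = η * K → K * L = L * K →
        (s K)ᵀ * η = η * s K ∧ s K * L = L * s K ∧ s K * K * s K = 1) := by
  let S : Submodule ℝ (Matrix n n ℝ) :=
    { carrier := {X | Xᵀ * η = η * X ∧ X * L = L * X}
      add_mem' := by
        rintro a b ⟨h1, h2⟩ ⟨h3, h4⟩
        simp only [Set.mem_ofPred_eq, Matrix.transpose_add, add_mul, mul_add] at *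
        exact ⟨by rw [h1, h3], by rw [h2, h4]⟩
      zero_mem' := by simp
      smul_mem' := by
        rintro c a ⟨h1, h2⟩
        simp only [Set.mem_ofPred_eq, Matrix.transpose_smul, smul_mul_assoc, mul_smul_comm] at *
        exact ⟨by rw [h1], by rw [h2]⟩ }
  have hS : ∀ X, X ∈ S ↔ Xᵀ * η = η * X ∧ X * L = L * X := fun X => Iff.rfl
  -- `S` need not be closed under products, but it is closed under squares. Inverting the squaring
  -- map inside `S` gives roots with the required symmetry for free.
  have hsq : ∀ X ∈ S, X * X ∈ S := by
    intro X hX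
    rw [hS] at hX ⊢
    constructor
    · rw [Matrix.transpose_mul, mul_assoc, hX.1, ← mul_assoc, hX.1, mul_assoc]
    · rw [mul_assoc, hX.2, ← mul_assoc, hX.2, mul_assoc]
  have h1S : (1 : Matrix n n ℝ) ∈ S := by simp [hS]
  obtain ⟨π', hπ'⟩ := S.subtype.exists_leftInverse_of_injective
    (LinearMap.ker_eq_bot.2 Subtype.val_injective)
  -- A linear projection onto `S` lets the root be defined, and smooth, on a full neighbourhood of
  -- `1`.
  let π : Matrix n n ℝ →L[ℝ] S := LinearMap.toContinuousLinearMap π'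
  have hπ : ∀ x : S, π x = x := fun x => LinearMap.congr_fun hπ' x
  let q : S → S := fun X => π ((X : Matrix n n ℝ) * X)
  have hq : ∀ X : S, (q X : Matrix n n ℝ) = X * X := fun X => by
    have := hπ ⟨_, hsq X X.2⟩
    exact congrArg Subtype.val this
  let ι : S →L[ℝ] Matrix n n ℝ := S.subtypeL
  have hqd : ContDiff ℝ ω q :=
    π.contDiff.comp (ι.contDiff.mul ι.contDiff)
  let one : S := ⟨1, h1S⟩
  let two : S ≃L[ℝ] S := ContinuousLinearEquiv.smulLeft (Units.mk0 (2 : ℝ) two_ne_zero)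
  have hqone : q one = one := Subtype.ext (by rw [hq]; simp [one])
  -- The derivative of squaring at `1` is multiplication by 2, so the inverse function theorem
  -- applies.
  have hder : HasFDerivAt q (two : S →L[ℝ] S) one := by
    have h := π.hasFDerivAt.comp one ((ι.hasFDerivAt (x := one)).mul' (ι.hasFDerivAt (x := one)))
    refine h.congr_fderiv ?_
    ext1 X
    have h2 : ι one = 1 := rfl
    have h3 : π (ι X) = X := hπ X
    have h4 : two X = (2 : ℝ) • X := rfl
    change π (ι one * ι X + ι X * ι one) = two X
    rw [h2, one_mul, mul_one, map_add, h3, h4, two_smul]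
  have hω : ContDiffAt ℝ ω q one := hqd.contDiffAt
  have hs := hω.hasStrictFDerivAt' hder (by simp)
  have hinv1 := hω.localInverse_apply_image hder (by simp)
  have hinv2 := hω.to_localInverse hder (by simp)
  set r : S → S := hω.localInverse hder (by simp) with hr
  have hright : ∀ᶠ y in 𝓝 one, q (r y) = y := by
    have := hs.eventually_right_inverse
    rwa [hqone] at this
  rw [hqone] at hinv1 hinv2
  have hrev : ∀ᶠ y in 𝓝 one, ContDiffAt ℝ ω r y := hinv2.eventually (by simp)
  have hπ1 : π 1 = one := hπ one
  have hπc : Filter.Tendsto π (𝓝 1) (𝓝 one) := hπ1 ▸ π.continuous.tendsto 1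
  have hunit : ∀ᶠ y in 𝓝 one, IsUnit (ι (r y)) := by
    have hc : ContinuousAt (fun y => ι (r y)) one := ι.continuous.continuousAt.comp
      hinv2.continuousAt
    have h2 : ι (r one) = 1 := by rw [hinv1]; rfl
    apply hc.eventually
    simp only [h2]
    exact Units.isOpen.mem_nhds isUnit_one
  refine ⟨fun K => Ring.inverse (ι (r (π K))), ?_, ?_⟩
  · have h2 : ι one = 1 := rfl
    simp [hπ1, hinv1, h2]
  filter_upwards [hπc.eventually hright, hπc.eventually hrev, hπc.eventually hunit] with K h1 h2 h3
  constructor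
  · have h4 : ContDiffAt ℝ ∞ Ring.inverse (ι (r (π K))) := by
      obtain ⟨w, hw⟩ := h3
      exact hw ▸ contDiffAt_ringInverse ℝ w
    have h5 : ContDiffAt ℝ ∞ (fun K => ι (r (π K))) K :=
      ι.contDiff.contDiffAt.comp K ((h2.of_le le_top).comp K π.contDiff.contDiffAt)
    exact h4.comp K h5
  · intro hK1 hK2
    set X : Matrix n n ℝ := ι (r (π K)) with hX
    have hXS : X ∈ S := (r (π K)).2
    have hXK : X * X = K := by
      have h6 : π K = ⟨K, hK1, hK2⟩ := hπ ⟨K, hK1, hK2⟩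
      have h7 := congrArg Subtype.val h1
      rw [hq] at h7
      rw [hX, h6] at *
      exact h7
    have hdet : IsUnit X.det := (Matrix.isUnit_iff_isUnit_det X).1 h3
    have hdet' : IsUnit Xᵀ.det := by rwa [Matrix.det_transpose]
    obtain ⟨hX1, hX2⟩ := (hS X).1 hXS
    change (Ring.inverse X)ᵀ * η = η * Ring.inverse X ∧ _ * L = L * Ring.inverse X ∧
      Ring.inverse X * K * Ring.inverse X = 1
    rw [← Matrix.nonsing_inv_eq_ringInverse]
    refine ⟨?_, ?_, ?_⟩
    · calc X⁻¹ᵀ * η = Xᵀ⁻¹ * (η * X) * X⁻¹ := by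
            rw [Matrix.transpose_nonsing_inv, ← mul_assoc,
              Matrix.mul_nonsing_inv_cancel_right _ _ hdet]
        _ = η * X⁻¹ := by rw [← hX1, Matrix.nonsing_inv_mul_cancel_left _ _ hdet']
    · calc X⁻¹ * L = X⁻¹ * (L * X) * X⁻¹ := by
            rw [← mul_assoc, Matrix.mul_nonsing_inv_cancel_right _ _ hdet]
        _ = L * X⁻¹ := by rw [← hX2, Matrix.nonsing_inv_mul_cancel_left _ _ hdet]
    · rw [← hXK, Matrix.nonsing_inv_mul_cancel_left _ _ hdet, Matrix.mul_nonsing_inv _ hdet]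

open Polynomial in
/-- Real matrices that are intertwined by an invertible complex matrix are intertwined by an
invertible real one. -/
theorem exists_real_intertwiner {A B : Matrix n n ℝ} {P : Matrix n n ℂ} (hP : IsUnit P)
    (h : A.map (algebraMap ℝ ℂ) * P = P * B.map (algebraMap ℝ ℂ)) :
    ∃ Q : Matrix n n ℝ, IsUnit Q ∧ A * Q = Q * B := by
  have hre : A * P.map Complex.re = P.map Complex.re * B := by
    ext i j
    have := congrArg Complex.re (congrFun (congrFun h i) j)
    simpa [Matrix.mul_apply] using this
  have him : A * P.map Complex.im = P.map Complex.im * B := by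
    ext i j
    have := congrArg Complex.im (congrFun (congrFun h i) j)
    simpa [Matrix.mul_apply] using this
  -- Every real combination `Re P + t Im P` intertwines. Its determinant is a polynomial in `t` that
  -- is nonzero at `t = i`, hence nonzero at some real `t`.
  let M : Matrix n n ℝ[X] := (P.map Complex.re).map C + (X : ℝ[X]) • (P.map Complex.im).map C
  have hM : M.det ≠ 0 := by
    intro h0
    have h1 : (eval₂RingHom (algebraMap ℝ ℂ) Complex.I) M.det = P.det := by
      rw [RingHom.map_det]
      congr 1
      ext i j
      simp [M]
    rw [h0, map_zero] at h1
    exact ((Matrix.isUnit_iff_isUnit_det P).1 hP).ne_zero h1.symm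
  obtain ⟨t, ht⟩ : ∃ t : ℝ, M.det.eval t ≠ 0 := by
    by_contra! hall
    exact hM (Polynomial.funext (by simpa using hall))
  have h2 : (evalRingHom t) M.det = (P.map Complex.re + t • P.map Complex.im).det := by
    rw [RingHom.map_det]
    congr 1
    ext i j
    simpa [M] using mul_comm _ _
  refine ⟨P.map Complex.re + t • P.map Complex.im, ?_, ?_⟩
  · rw [Matrix.isUnit_iff_isUnit_det, ← h2]
    exact IsUnit.mk0 _ ht
  · rw [mul_add, add_mul, mul_smul_comm, smul_mul_assoc, hre, him]

/-! ### Smooth continuation of intertwiners along a similarity class -/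

section Intertwiner

variable {R : Type*} [NormedRing R] [NormedAlgebra ℝ R]

/-- The linear map `x ↦ a x - x a₀`. -/
def intertwinerMap (a₀ a : R) : R →L[ℝ] R :=
  ContinuousLinearMap.mul ℝ R a - (ContinuousLinearMap.mul ℝ R).flip a₀

theorem intertwinerMap_apply (a₀ a x : R) : intertwinerMap a₀ a x = a * x - x * a₀ := by
  simp [intertwinerMap]

variable [FiniteDimensional ℝ R]

/-- With `x = u y` one has `a x - x a₀ = u (a₀ y - y a₀)`, so left multiplication by `u` carries the
range at `a₀` onto a space containing the range at `a`. This is the rank bound needed to continue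
kernel vectors. -/
theorem finrank_range_intertwinerMap_le {a₀ a u : R} (hu : IsUnit u) (h : a * u = u * a₀) :
    Module.finrank ℝ (intertwinerMap a₀ a).range ≤
      Module.finrank ℝ (intertwinerMap a₀ a₀).range := by
  have hle : (intertwinerMap a₀ a).range ≤
      (intertwinerMap a₀ a₀).range.map (LinearMap.mulLeft ℝ u) := by
    rintro _ ⟨x, rfl⟩
    refine ⟨_, ⟨Ring.inverse u * x, rfl⟩, ?_⟩
    have h1 : u * (Ring.inverse u * x) = x := Ring.mul_inverse_cancel_left _ _ hu
    simp only [ContinuousLinearMap.coe_coe, intertwinerMap_apply, LinearMap.mulLeft_apply, mul_sub]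
    rw [← mul_assoc u a₀, ← h, mul_assoc, h1, ← mul_assoc, h1]
  exact (Submodule.finrank_mono hle).trans (Submodule.finrank_map_le _ _)

/-- Elements near `a₀` that are similar to `a₀` are intertwined with `a₀` by an element near `1`
that depends smoothly on them. -/
theorem exists_smooth_intertwiner (a₀ : R) :
    ∃ F : R → R, F a₀ = 1 ∧ ∀ᶠ a in 𝓝 a₀, ContDiffAt ℝ ∞ F a ∧
      ((∃ u : R, IsUnit u ∧ a * u = u * a₀) → a * F a = F a * a₀) := by
  obtain ⟨F, hF, hev⟩ := exists_smooth_kernel_section (intertwinerMap a₀ a₀) 1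
    (by simp [intertwinerMap_apply])
  have hc : ContDiff ℝ ∞ (intertwinerMap a₀) :=
    (ContinuousLinearMap.mul ℝ R).contDiff.sub contDiff_const
  refine ⟨fun a => F (intertwinerMap a₀ a), hF, ?_⟩
  filter_upwards [hc.continuous.continuousAt.eventually hev] with a ha
  refine ⟨ha.1.comp a hc.contDiffAt, ?_⟩
  rintro ⟨u, hu, h⟩
  have := ha.2 (finrank_range_intertwinerMap_le hu h)
  rwa [intertwinerMap_apply, sub_eq_zero] at this

end Intertwiner

/-- The lower right block of a `4 × 4` matrix. -/
def lowerBlock (J : Matrix (Fin 4) (Fin 4) ℝ) : Matrix (Fin 3) (Fin 3) ℝ :=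
  J.submatrix Fin.succ Fin.succ

/-- A smooth family of self-adjoint `3 × 3` matrices, similar to each other after the addition of a
zero row and a zero column, is conjugated to a constant one by isometries that depend smoothly on
the parameter. -/
theorem exists_smooth_isometric_intertwiner (η : Matrix (Fin 3) (Fin 3) ℝ) (hη : η * η = 1)
    (hηt : ηᵀ = η) (J₀ : Matrix (Fin 4) (Fin 4) ℝ) (hJ₀ : ∀ i, J₀ 0 i = 0 ∧ J₀ i 0 = 0)
    (hsa₀ : (lowerBlock J₀)ᵀ * η = η * lowerBlock J₀) :
    ∃ F : Matrix (Fin 4) (Fin 4) ℝ → Matrix (Fin 3) (Fin 3) ℝ, ∀ᶠ J in 𝓝 J₀, ContDiffAt ℝ ∞ F J ∧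
      ((∀ i, J 0 i = 0 ∧ J i 0 = 0) → (lowerBlock J)ᵀ * η = η * lowerBlock J →
        (∃ Q : Matrix (Fin 4) (Fin 4) ℝ, IsUnit Q ∧ J * Q = Q * J₀) →
        (F J)ᵀ * η * F J = η ∧ lowerBlock J * F J = F J * lowerBlock J₀) := by
  obtain ⟨F, hF, hFev⟩ := exists_smooth_intertwiner J₀
  obtain ⟨s, hs1, hsev⟩ := exists_smooth_inverse_sqrt η (lowerBlock J₀)
  let bl : Matrix (Fin 4) (Fin 4) ℝ →L[ℝ] Matrix (Fin 3) (Fin 3) ℝ :=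
    LinearMap.toContinuousLinearMap
      { toFun := lowerBlock, map_add' := fun _ _ => rfl, map_smul' := fun _ _ => rfl }
  have hbl : ∀ X, bl X = lowerBlock X := fun _ => rfl
  let tr : Matrix (Fin 3) (Fin 3) ℝ →L[ℝ] Matrix (Fin 3) (Fin 3) ℝ :=
    LinearMap.toContinuousLinearMap (Matrix.transposeLinearEquiv (Fin 3) (Fin 3) ℝ ℝ).toLinearMap
  have htr : ∀ X, tr X = Xᵀ := fun _ => rfl
  -- `k J` is `D* D` for the `η`-adjoint `D* = η Dᵀ η`; multiplying `D` by its inverse square root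
  -- is the polar decomposition.
  let k : Matrix (Fin 4) (Fin 4) ℝ → Matrix (Fin 3) (Fin 3) ℝ := fun J =>
    η * (tr (bl (F J)) * η * bl (F J))
  have hk0 : k J₀ = 1 := by
    have h1 : lowerBlock (1 : Matrix (Fin 4) (Fin 4) ℝ) = 1 := by
      ext i j; simp [lowerBlock, Matrix.one_apply]
    simp [k, hF, hbl, htr, h1, hη]
  have hkd : ∀ J, ContDiffAt ℝ ∞ F J → ContDiffAt ℝ ∞ k J := by
    intro J hJ
    have h1 : ContDiffAt ℝ ∞ (fun J => bl (F J)) J := bl.contDiff.contDiffAt.comp J hJ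
    have h2 : ContDiffAt ℝ ∞ (fun J => tr (bl (F J))) J := tr.contDiff.contDiffAt.comp J h1
    exact contDiffAt_const.mul ((h2.mul contDiffAt_const).mul h1)
  have hkc : Filter.Tendsto k (𝓝 J₀) (𝓝 1) := by
    have := (hkd J₀ hFev.self_of_nhds.1).continuousAt
    rwa [ContinuousAt, hk0] at this
  refine ⟨fun J => bl (F J) * s (k J), ?_⟩
  filter_upwards [hFev, hkc.eventually hsev] with J h1 h2
  refine ⟨(bl.contDiff.contDiffAt.comp J h1.1).mul (h2.1.comp J (hkd J h1.1)), ?_⟩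
  intro hJ hsa hsim
  have e1 := h1.2 hsim
  set T := lowerBlock J
  set T₀ := lowerBlock J₀
  set D := bl (F J) with hD
  -- The zero borders of `J` and `J₀` remove the mixed terms, so the blocks intertwine by
  -- themselves.
  have e2 : T * D = D * T₀ := by
    ext i j
    have := congrFun (congrFun e1 i.succ) j.succ
    simpa [Matrix.mul_apply, Fin.sum_univ_succ, hJ, hJ₀, hD, hbl, T, T₀, lowerBlock] using this
  have e2t : Dᵀ * Tᵀ = T₀ᵀ * Dᵀ := by
    rw [← Matrix.transpose_mul, ← Matrix.transpose_mul, e2]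
  have hk : k J = η * (Dᵀ * η * D) := rfl
  have e3 : (k J)ᵀ * η = η * k J := by
    have : (k J)ᵀ = Dᵀ * η * D * η := by
      rw [hk]; simp [hηt, mul_assoc]
    rw [this, hk, mul_assoc, hη, mul_one, ← mul_assoc η η, hη, one_mul]
  -- Taking adjoints in `T D = D T₀` gives `D* T = T₀ D*`; the two relations make `D* D` commute
  -- with `T₀`.
  have e4 : k J * T₀ = T₀ * k J := by
    have h0 : η * T₀ᵀ = T₀ * η := by
      have := congrArg (fun X => η * X * η) hsa₀
      simp only [mul_assoc, hη, mul_one] at this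
      rw [this, ← mul_assoc, hη, one_mul]
    calc k J * T₀ = η * (Dᵀ * η * (D * T₀)) := by rw [hk]; simp only [mul_assoc]
      _ = η * (Dᵀ * (η * T) * D) := by rw [← e2]; simp only [mul_assoc]
      _ = η * (Dᵀ * Tᵀ * (η * D)) := by rw [← hsa]; simp only [mul_assoc]
      _ = T₀ * k J := by rw [e2t, mul_assoc T₀ᵀ, ← mul_assoc η, h0, hk]; simp only [mul_assoc]
  obtain ⟨f1, f2, f3⟩ := h2.2 e3 e4
  constructor
  · have hηk : η * k J = Dᵀ * η * D := by rw [hk, ← mul_assoc, hη, one_mul]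
    calc (D * s (k J))ᵀ * η * (D * s (k J))
        = (s (k J))ᵀ * (Dᵀ * η * D) * s (k J) := by
          rw [Matrix.transpose_mul]; simp only [mul_assoc]
      _ = η * (s (k J) * k J * s (k J)) := by
          rw [← hηk, ← mul_assoc, f1]; simp only [mul_assoc]
      _ = η := by rw [f3, mul_one]
  · rw [← mul_assoc, e2, mul_assoc, ← f2, mul_assoc]

end MatrixEquations

/-! ### Normal forms of self-adjoint operators on a Lorentzian three-space -/

section NormalForms

/-- The Gram matrix of signature `(-, +, +)`. -/
def lorentzGram : Matrix (Fin 3) (Fin 3) ℝ := !![-1, 0, 0; 0, 1, 0; 0, 0, 1]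

theorem lorentzGram_mul_self : lorentzGram * lorentzGram = 1 := by
  ext i j; fin_cases i <;> fin_cases j <;> simp [lorentzGram]

theorem lorentzGram_transpose : lorentzGramᵀ = lorentzGram := by
  ext i j; fin_cases i <;> fin_cases j <;> simp [lorentzGram]

/-- `T` becomes `S` after a Lorentz transformation. -/
def LorentzConj (T S : Matrix (Fin 3) (Fin 3) ℝ) : Prop :=
  ∃ A : Matrix (Fin 3) (Fin 3) ℝ, Aᵀ * lorentzGram * A = lorentzGram ∧ T * A = A * S

theorem LorentzConj.refl (T : Matrix (Fin 3) (Fin 3) ℝ) : LorentzConj T T :=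
  ⟨1, by simp, by simp⟩

theorem LorentzConj.trans {T S R : Matrix (Fin 3) (Fin 3) ℝ} (h : LorentzConj T S)
    (h' : LorentzConj S R) : LorentzConj T R := by
  obtain ⟨A, hA, hA'⟩ := h
  obtain ⟨B, hB, hB'⟩ := h'
  refine ⟨A * B, ?_, ?_⟩
  · calc (A * B)ᵀ * lorentzGram * (A * B) = Bᵀ * (Aᵀ * lorentzGram * A) * B := by
          simp only [Matrix.transpose_mul, mul_assoc]
      _ = lorentzGram := by rw [hA, hB]
  · rw [← mul_assoc, hA', mul_assoc, hB', mul_assoc]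

/-- Self-adjointness with respect to the Lorentzian form. -/
def IsLorentzSelfAdjoint (T : Matrix (Fin 3) (Fin 3) ℝ) : Prop :=
  Tᵀ * lorentzGram = lorentzGram * T

theorem LorentzConj.isLorentzSelfAdjoint {T S : Matrix (Fin 3) (Fin 3) ℝ} (h : LorentzConj T S)
    (hT : IsLorentzSelfAdjoint T) : IsLorentzSelfAdjoint S := by
  obtain ⟨A, hA, hA'⟩ := h
  have e1 : Aᵀ * lorentzGram * T * A = lorentzGram * S := by
    rw [mul_assoc, hA', ← mul_assoc, hA]
  have e2 : (Aᵀ * lorentzGram * T * A)ᵀ = Aᵀ * lorentzGram * T * A := by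
    simp only [Matrix.transpose_mul, Matrix.transpose_transpose, lorentzGram_transpose]
    rw [← mul_assoc Tᵀ, hT]
    simp only [mul_assoc]
  rw [e1, Matrix.transpose_mul, lorentzGram_transpose] at e2
  exact e2

theorem IsLorentzSelfAdjoint.eq_entries {T : Matrix (Fin 3) (Fin 3) ℝ}
    (hT : IsLorentzSelfAdjoint T) :
    ∃ p q r x y z : ℝ, T = !![p, q, x; -q, r, y; -x, y, z] := by
  refine ⟨T 0 0, T 0 1, T 1 1, T 0 2, T 1 2, T 2 2, ?_⟩
  have h01 := congrFun (congrFun hT 0) 1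
  have h02 := congrFun (congrFun hT 0) 2
  have h12 := congrFun (congrFun hT 1) 2
  simp [lorentzGram, Matrix.mul_apply, Fin.sum_univ_succ] at h01 h02 h12
  ext i j
  fin_cases i <;> fin_cases j <;> simp [h01, h02, h12]

/-- The hyperbolic rotation in the first two coordinates. -/
theorem lorentzConj_boost {p q r z c s : ℝ} (h : c ^ 2 - s ^ 2 = 1) :
    LorentzConj !![p, q, 0; -q, r, 0; 0, 0, z]
      !![p * c ^ 2 + 2 * q * c * s - r * s ^ 2, (p - r) * c * s + q * (c ^ 2 + s ^ 2), 0;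
        -((p - r) * c * s + q * (c ^ 2 + s ^ 2)), r * c ^ 2 - 2 * q * c * s - p * s ^ 2, 0;
        0, 0, z] := by
  refine ⟨!![c, s, 0; s, c, 0; 0, 0, 1], ?_, ?_⟩
  · ext i j
    fin_cases i <;> fin_cases j <;>
      simp [lorentzGram, Matrix.mul_apply, Fin.sum_univ_succ] <;>
      first | linear_combination h | linear_combination -h | ring
  · ext i j
    fin_cases i <;> fin_cases j <;> simp [Matrix.mul_apply, Fin.sum_univ_succ]
    · linear_combination (-(p * c + q * s)) * h
    · linear_combination (-(p * s + q * c)) * h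
    · linear_combination (-(-q * c + r * s)) * h
    · linear_combination (-(-q * s + r * c)) * h

theorem exists_half_hyperbolic_angle {C S : ℝ} (hC : 0 < C) (h : C ^ 2 - S ^ 2 = 1) :
    ∃ c s : ℝ, c ^ 2 - s ^ 2 = 1 ∧ c ^ 2 + s ^ 2 = C ∧ 2 * c * s = S := by
  have hc : 0 < √((C + 1) / 2) := Real.sqrt_pos.2 (by linarith)
  have hc2 : √((C + 1) / 2) ^ 2 = (C + 1) / 2 := Real.sq_sqrt (by linarith)
  set c := √((C + 1) / 2)
  have hs2 : (S / (2 * c)) ^ 2 = (C - 1) / 2 := by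
    rw [div_pow, mul_pow, hc2, div_eq_iff (by linarith)]
    linear_combination -h
  refine ⟨c, S / (2 * c), ?_, ?_, by field_simp⟩ <;> rw [hs2, hc2] <;> ring

/-- In terms of half the trace `m` and the pair `(d, q)`, a boost fixes `m` and acts on `(d, q)` as
a hyperbolic rotation by twice the angle. The sign of the invariant `d² - q²` therefore decides
which normal form is reached, and only the doubled-angle parameters `C`, `S` need to be chosen. -/
theorem lorentzConj_boost' {m d q z C S : ℝ} (hC : 0 < C) (h : C ^ 2 - S ^ 2 = 1) :
    LorentzConj !![m - d, q, 0; -q, m + d, 0; 0, 0, z]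
      !![m - (d * C - q * S), q * C - d * S, 0; -(q * C - d * S), m + (d * C - q * S), 0;
        0, 0, z] := by
  obtain ⟨c, s, h1, h2, h3⟩ := exists_half_hyperbolic_angle hC h
  convert lorentzConj_boost (p := m - d) (q := q) (r := m + d) (z := z) h1 using 1
  subst h2 h3
  ext i j
  fin_cases i <;> fin_cases j <;> simp <;>
    first | linear_combination (-m) * h1 | linear_combination m * h1 | ring

/-- Reflecting the second basis vector reduces the null case `d = -q` to `d = q`. -/
theorem lorentzConj_flip {p q r z : ℝ} :
    LorentzConj !![p, q, 0; -q, r, 0; 0, 0, z] !![p, -q, 0; q, r, 0; 0, 0, z] := by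
  refine ⟨!![1, 0, 0; 0, -1, 0; 0, 0, 1], ?_, ?_⟩ <;> ext i j <;>
    fin_cases i <;> fin_cases j <;> simp [lorentzGram, Matrix.mul_apply, Fin.sum_univ_succ]

/-- Operators with a spacelike eigenvector and a defective restriction to its complement. -/
theorem exists_normalForm_of_parabolic {m q z : ℝ} (hq : q ≠ 0) :
    ∃ S, IsNormalForm S ∧ LorentzConj !![m - q, q, 0; -q, m + q, 0; 0, 0, z] S := by
  have hk : 0 < |q| := abs_pos.2 hq
  -- With `C - S = k`, the boost multiplies the null pair `(q, q)` by `k`; this `k` normalises `q`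
  -- to `±1/2`.
  set k := 1 / (2 * |q|) with hkdef
  have hk0 : 0 < k := by positivity
  have hb := lorentzConj_boost' (m := m) (d := q) (q := q) (z := z)
    (C := (k + 1 / k) / 2) (S := (1 / k - k) / 2) (by positivity) (by field_simp; ring)
  have e1 : q * ((k + 1 / k) / 2) - q * ((1 / k - k) / 2) = q * k := by ring
  rw [e1] at hb
  rcases lt_or_gt_of_ne hq with h | h
  · have e2 : q * k = -1 / 2 := by rw [hkdef, abs_of_neg h]; field_simp
    rw [e2] at hb
    refine ⟨_, ?_, hb⟩
    right; right; left
    -- In type III the sign multiplies `α` as well, hence the parameter `-m`.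
    refine ⟨-1, -m, z, Or.inr rfl, ?_⟩
    ext i j; fin_cases i <;> fin_cases j <;> simp [typeIII] <;> ring
  · have e2 : q * k = 1 / 2 := by rw [hkdef, abs_of_pos h]; field_simp
    rw [e2] at hb
    refine ⟨_, ?_, hb⟩
    right; right; left
    refine ⟨1, m, z, Or.inl rfl, ?_⟩
    ext i j; fin_cases i <;> fin_cases j <;> simp [typeIII]

/-- Operators that have the last basis vector as an eigenvector. -/
theorem exists_normalForm_of_block (p q r z : ℝ) :
    ∃ S, IsNormalForm S ∧ LorentzConj !![p, q, 0; -q, r, 0; 0, 0, z] S := by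
  obtain ⟨m, d, rfl, rfl⟩ : ∃ m d, p = m - d ∧ r = m + d :=
    ⟨(p + r) / 2, (r - p) / 2, by ring, by ring⟩
  rcases lt_trichotomy (d ^ 2) (q ^ 2) with h | h | h
  · -- complex eigenvalues
    have hr : 0 < √(q ^ 2 - d ^ 2) := Real.sqrt_pos.2 (by linarith)
    have hr2 : √(q ^ 2 - d ^ 2) ^ 2 = q ^ 2 - d ^ 2 := Real.sq_sqrt (by linarith)
    set R := √(q ^ 2 - d ^ 2)
    have hq : q ≠ 0 := by rintro rfl; nlinarith [sq_nonneg d]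
    have hq' : 0 < |q| := abs_pos.2 hq
    have hqq : |q| ^ 2 = q ^ 2 := sq_abs q
    -- Here `S / C = d / q`, so the boost sends `d` to zero; the absolute value makes `C` positive.
    have hb := lorentzConj_boost' (m := m) (d := d) (q := q) (z := z)
      (C := |q| / R) (S := d * |q| / (q * R)) (by positivity)
      (by field_simp; rw [hqq, hr2]; ring)
    refine ⟨_, ?_, hb⟩
    right; left
    have e1 : d * (|q| / R) - q * (d * |q| / (q * R)) = 0 := by field_simp; ring
    have e2 : q * (|q| / R) - d * (d * |q| / (q * R)) ≠ 0 := by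
      have : q * (|q| / R) - d * (d * |q| / (q * R)) = |q| * R / q := by
        field_simp; rw [hr2]
      rw [this]
      positivity
    refine ⟨m, _, z, e2, ?_⟩
    rw [e1]
    ext i j; fin_cases i <;> fin_cases j <;> simp [typeII]
  · rcases eq_or_ne q 0 with rfl | hq
    · refine ⟨_, ?_, LorentzConj.refl _⟩
      left
      exact ⟨m - d, m + d, z, by ext i j; fin_cases i <;> fin_cases j <;> simp [typeI]⟩
    · rcases sq_eq_sq_iff_eq_or_eq_neg.1 h with rfl | rfl
      · exact exists_normalForm_of_parabolic hq
      · obtain ⟨S, hS, hS'⟩ := exists_normalForm_of_parabolic (m := m) (z := z) (neg_ne_zero.2 hq)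
        rw [neg_neg] at hS'
        exact ⟨S, hS, lorentzConj_flip.trans hS'⟩
  · have hr : 0 < √(d ^ 2 - q ^ 2) := Real.sqrt_pos.2 (by linarith)
    have hr2 : √(d ^ 2 - q ^ 2) ^ 2 = d ^ 2 - q ^ 2 := Real.sq_sqrt (by linarith)
    set R := √(d ^ 2 - q ^ 2)
    have hq : d ≠ 0 := by rintro rfl; nlinarith [sq_nonneg q]
    have hq' : 0 < |d| := abs_pos.2 hq
    have hqq : |d| ^ 2 = d ^ 2 := sq_abs d
    -- Here `S / C = q / d`, so the boost sends `q` to zero and diagonalises the block.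
    have hb := lorentzConj_boost' (m := m) (d := d) (q := q) (z := z)
      (C := |d| / R) (S := q * |d| / (d * R)) (by positivity)
      (by field_simp; rw [hqq, hr2]; ring)
    refine ⟨_, ?_, hb⟩
    left
    have e1 : q * (|d| / R) - d * (q * |d| / (d * R)) = 0 := by field_simp; ring
    rw [e1, neg_zero]
    exact ⟨_, _, z, rfl⟩

/-- The inverse of a Lorentz matrix `A` is `η Aᵀ η`, and `S = A⁻¹ T A`. If `A` moves a standard
vector `v` to an eigenvector of `T`, then `v` is an eigenvector of `S`, which fixes a column of `S`.
-/
theorem exists_conj_of_isometry {A T : Matrix (Fin 3) (Fin 3) ℝ}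
    (hA : Aᵀ * lorentzGram * A = lorentzGram) (hT : IsLorentzSelfAdjoint T) :
    ∃ S, IsLorentzSelfAdjoint S ∧ LorentzConj T S ∧
      ∀ v (l : ℝ), T *ᵥ (A *ᵥ v) = l • (A *ᵥ v) → S *ᵥ v = l • v := by
  have h1 : lorentzGram * Aᵀ * lorentzGram * A = 1 := by
    rw [mul_assoc, mul_assoc, ← mul_assoc Aᵀ, hA, lorentzGram_mul_self]
  have h2 := mul_eq_one_comm.1 h1
  set B := lorentzGram * Aᵀ * lorentzGram
  have h3 : LorentzConj T (B * T * A) := ⟨A, hA, by rw [mul_assoc B, ← mul_assoc A, h2, one_mul]⟩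
  refine ⟨B * T * A, h3.isLorentzSelfAdjoint hT, h3, fun v l h => ?_⟩
  rw [← Matrix.mulVec_mulVec, ← Matrix.mulVec_mulVec, h, Matrix.mulVec_smul, Matrix.mulVec_mulVec,
    h1, Matrix.one_mulVec]

/-- Operators with a unit spacelike eigenvector. -/
theorem exists_normalForm_of_spacelike {T : Matrix (Fin 3) (Fin 3) ℝ} (hT : IsLorentzSelfAdjoint T)
    {a b c l : ℝ} (hn : -a ^ 2 + b ^ 2 + c ^ 2 = 1) (h : T *ᵥ ![a, b, c] = l • ![a, b, c]) :
    ∃ S, IsNormalForm S ∧ LorentzConj T S := by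
  -- The sign choice makes `1 + c` nonzero, so that the sum of `(a, b, c)` and the last basis vector
  -- is not null and can be reflected in.
  wlog hc : 0 ≤ c generalizing a b c
  · refine this (a := -a) (b := -b) (c := -c) (by linarith) ?_ (by linarith)
    have : ![-a, -b, -c] = -![a, b, c] := by ext i; fin_cases i <;> simp
    rw [this, Matrix.mulVec_neg, h, smul_neg]
  obtain ⟨e, he⟩ : ∃ e, e * (1 + c) = 1 := ⟨(1 + c)⁻¹, inv_mul_cancel₀ (by positivity)⟩
  have he2 : e * (a ^ 2 - b ^ 2) = c - 1 := by linear_combination (c - 1) * he - e * hn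
  -- `A` is the reflection along `(a, b, c + 1)`; it exchanges the last basis vector with `-(a, b,
  -- c)`.
  let A : Matrix (Fin 3) (Fin 3) ℝ :=
    !![1 + a ^ 2 * e, -(a * b * e), -a; a * b * e, 1 - b ^ 2 * e, -b; a, -b, -c]
  have hA : Aᵀ * lorentzGram * A = lorentzGram := by
    ext i j
    fin_cases i <;> fin_cases j <;>
      simp [A, lorentzGram, Matrix.mul_apply, Fin.sum_univ_succ]
    · linear_combination (-a ^ 2 * e) * he2 - a ^ 2 * he
    · linear_combination (a * b * e) * he2 + a * b * he
    · linear_combination a * he2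
    · linear_combination (a * b * e) * he2 + a * b * he
    · linear_combination (-b ^ 2 * e) * he2 - b ^ 2 * he
    · linear_combination (-b) * he2
    · linear_combination a * he2
    · linear_combination (-b) * he2
    · linear_combination hn
  have hAv : A *ᵥ ![0, 0, 1] = (-1 : ℝ) • ![a, b, c] := by
    ext i; fin_cases i <;> simp [A, Matrix.mulVec, dotProduct, Fin.sum_univ_succ]
  obtain ⟨S, hS, hTS, hv⟩ := exists_conj_of_isometry hA hT
  have h1 := hv ![0, 0, 1] l (by rw [hAv, Matrix.mulVec_smul, h, smul_comm])
  obtain ⟨p, q, r, x, y, z, rfl⟩ := hS.eq_entries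
  have hx := congrFun h1 0
  have hy := congrFun h1 1
  simp [Matrix.mulVec, dotProduct, Fin.sum_univ_succ] at hx hy
  subst hx hy
  rw [neg_zero] at hTS
  obtain ⟨S', h2, h3⟩ := exists_normalForm_of_block p q r z
  exact ⟨S', h2, hTS.trans h3⟩

/-- Operators with a unit timelike eigenvector. -/
theorem exists_normalForm_of_timelike {T : Matrix (Fin 3) (Fin 3) ℝ} (hT : IsLorentzSelfAdjoint T)
    {a b c l : ℝ} (hn : a ^ 2 - b ^ 2 - c ^ 2 = 1) (h : T *ᵥ ![a, b, c] = l • ![a, b, c]) :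
    ∃ S, IsNormalForm S ∧ LorentzConj T S := by
  wlog hc : 0 ≤ a generalizing a b c
  · refine this (a := -a) (b := -b) (c := -c) (by linarith) ?_ (by linarith)
    have : ![-a, -b, -c] = -![a, b, c] := by ext i; fin_cases i <;> simp
    rw [this, Matrix.mulVec_neg, h, smul_neg]
  obtain ⟨e, he⟩ : ∃ e, e * (1 + a) = 1 := ⟨(1 + a)⁻¹, inv_mul_cancel₀ (by positivity)⟩
  have he2 : e * (b ^ 2 + c ^ 2) = a - 1 := by linear_combination (a - 1) * he - e * hn
  -- `A` is the reflection along `(a + 1, b, c)`; it exchanges the first basis vector with `-(a, b,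
  -- c)`.
  let A : Matrix (Fin 3) (Fin 3) ℝ :=
    !![-a, b, c; -b, 1 + b ^ 2 * e, b * c * e; -c, b * c * e, 1 + c ^ 2 * e]
  have hA : Aᵀ * lorentzGram * A = lorentzGram := by
    ext i j
    fin_cases i <;> fin_cases j <;>
      simp [A, lorentzGram, Matrix.mul_apply, Fin.sum_univ_succ]
    · linear_combination -hn
    · linear_combination (-b) * he2
    · linear_combination (-c) * he2
    · linear_combination (-b) * he2
    · linear_combination (b ^ 2 * e) * he2 + b ^ 2 * he
    · linear_combination (b * c * e) * he2 + b * c * he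
    · linear_combination (-c) * he2
    · linear_combination (b * c * e) * he2 + b * c * he
    · linear_combination (c ^ 2 * e) * he2 + c ^ 2 * he
  have hAv : A *ᵥ ![1, 0, 0] = (-1 : ℝ) • ![a, b, c] := by
    ext i; fin_cases i <;> simp [A, Matrix.mulVec, dotProduct, Fin.sum_univ_succ]
  obtain ⟨S, hS, hTS, hv⟩ := exists_conj_of_isometry hA hT
  have h1 := hv ![1, 0, 0] l (by rw [hAv, Matrix.mulVec_smul, h, smul_comm])
  obtain ⟨p, q, r, x, y, z, rfl⟩ := hS.eq_entries
  have hx := congrFun h1 1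
  have hy := congrFun h1 2
  simp [Matrix.mulVec, dotProduct, Fin.sum_univ_succ] at hx hy
  subst hx hy
  rw [neg_zero] at hTS
  -- The remaining block is symmetric on a definite plane. Rotation by half the argument of `(r -
  -- z)/2 + i y` annihilates its off-diagonal entry; using `arg` also covers `r = z`.
  have hw1 := Complex.norm_mul_cos_arg ⟨(r - z) / 2, y⟩
  have hw2 := Complex.norm_mul_sin_arg ⟨(r - z) / 2, y⟩
  set θ := Complex.arg ⟨(r - z) / 2, y⟩
  set ρ := ‖(⟨(r - z) / 2, y⟩ : ℂ)‖
  simp only at hw1 hw2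
  set C := Real.cos (θ / 2)
  set S := Real.sin (θ / 2)
  have hCS : S ^ 2 + C ^ 2 = 1 := Real.sin_sq_add_cos_sq _
  have hcos : Real.cos θ = C ^ 2 - S ^ 2 := by
    rw [← Real.cos_two_mul' (θ / 2)]; congr 1; ring
  have hsin : Real.sin θ = 2 * S * C := by
    rw [← Real.sin_two_mul (θ / 2)]; congr 1; ring
  have hoff : (z - r) * C * S + y * (C ^ 2 - S ^ 2) = 0 := by
    rw [hcos] at hw1
    rw [hsin] at hw2
    linear_combination (2 * C * S) * hw1 - (C ^ 2 - S ^ 2) * hw2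
  refine ⟨typeI p (r * C ^ 2 + 2 * y * C * S + z * S ^ 2) (r * S ^ 2 - 2 * y * C * S + z * C ^ 2),
    Or.inl ⟨_, _, _, rfl⟩, hTS.trans ⟨!![1, 0, 0; 0, C, -S; 0, S, C], ?_, ?_⟩⟩
  · ext i j
    fin_cases i <;> fin_cases j <;>
      simp [lorentzGram, Matrix.mul_apply, Fin.sum_univ_succ] <;>
      first | linear_combination hCS | ring
  · ext i j
    fin_cases i <;> fin_cases j <;>
      simp [typeI, Matrix.mul_apply, Fin.sum_univ_succ]
    · linear_combination (-(r * C + y * S)) * hCS - S * hoff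
    · linear_combination (-(-r * S + y * C)) * hCS + C * hoff
    · linear_combination (-(y * C + z * S)) * hCS + C * hoff
    · linear_combination (-(-y * S + z * C)) * hCS + S * hoff

/-- Operators with a null eigenvector. -/
theorem exists_normalForm_of_null {T : Matrix (Fin 3) (Fin 3) ℝ} (hT : IsLorentzSelfAdjoint T)
    {b c l : ℝ} (hn : b ^ 2 + c ^ 2 = 1) (h : T *ᵥ ![1, b, c] = l • ![1, b, c]) :
    ∃ S, IsNormalForm S ∧ LorentzConj T S := by
  let A : Matrix (Fin 3) (Fin 3) ℝ := !![1, 0, 0; 0, b, -c; 0, c, b]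
  have hA : Aᵀ * lorentzGram * A = lorentzGram := by
    ext i j
    fin_cases i <;> fin_cases j <;>
      simp [A, lorentzGram, Matrix.mul_apply, Fin.sum_univ_succ] <;>
      first | linear_combination hn | ring
  have hAv : A *ᵥ ![1, 1, 0] = ![1, b, c] := by
    ext i; fin_cases i <;> simp [A, Matrix.mulVec, dotProduct, Fin.sum_univ_succ]
  obtain ⟨S, hS, hTS, hv⟩ := exists_conj_of_isometry hA hT
  have h1 := hv ![1, 1, 0] l (by rw [hAv, h])
  obtain ⟨p, q, r, x, y, z, rfl⟩ := hS.eq_entries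
  have hp := congrFun h1 0
  have hr := congrFun h1 1
  have hx := congrFun h1 2
  simp [Matrix.mulVec, dotProduct, Fin.sum_univ_succ] at hp hr hx
  obtain rfl : x = y := by linarith
  obtain rfl : p = l - q := by linarith
  obtain rfl : r = l + q := by linarith
  -- In this case `(t, t, 1)` with `(z - l) t = x` is a unit spacelike eigenvector. Otherwise `l` is
  -- a triple eigenvalue and `x ≠ 0`.
  by_cases hxz : z ≠ l ∨ x = 0
  · obtain ⟨t, ht⟩ : ∃ t, (z - l) * t = x := by
      rcases hxz with hz | rfl
      · exact ⟨x / (z - l), by field_simp [sub_ne_zero.2 hz]⟩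
      · exact ⟨0, mul_zero _⟩
    obtain ⟨S', h2, h3⟩ := exists_normalForm_of_spacelike hS (a := t) (b := t) (c := 1) (l := z)
      (by ring) (by
        ext i; fin_cases i <;> simp [Matrix.mulVec, dotProduct, Fin.sum_univ_succ]
        · linear_combination -ht
        · linear_combination -ht)
    exact ⟨S', h2, hTS.trans h3⟩
  · push Not at hxz
    obtain ⟨rfl, hx0⟩ := hxz
    refine ⟨typeIV z, Or.inr (Or.inr (Or.inr ⟨z, rfl⟩)), hTS.trans ?_⟩
    have h2 : √2 ^ 2 = (2 : ℝ) := Real.sq_sqrt (by norm_num)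
    -- The matrix below multiplies the null vector `(1, 1, 0)` by `k = 1 / c` and includes a null
    -- rotation with parameter `t`. The factor `c` scales `x` to `√2 / 2`, and `q = 2 x t` makes the
    -- null rotation remove `q`.
    obtain ⟨c, k, hc, hk⟩ : ∃ c k : ℝ, x * c = √2 / 2 ∧ c * k = 1 :=
      ⟨√2 / 2 / x, x / (√2 / 2), by field_simp, by field_simp⟩
    obtain ⟨t, rfl⟩ : ∃ t, q = 2 * x * t := ⟨q / (2 * x), by field_simp⟩
    refine ⟨!![k / 2 + c * (1 / 2 + t ^ 2 / 2), k / 2 - c * (1 / 2 + t ^ 2 / 2), t;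
      k / 2 - c * (1 / 2 - t ^ 2 / 2), k / 2 + c * (1 / 2 - t ^ 2 / 2), t; c * t, -(c * t), 1],
      ?_, ?_⟩
    · ext i j
      fin_cases i <;> fin_cases j <;>
        simp [lorentzGram, Matrix.mul_apply, Fin.sum_univ_succ]
      all_goals first | linear_combination hk | linear_combination -hk | ring
    · ext i j
      fin_cases i <;> fin_cases j <;>
        simp [typeIV, Matrix.mul_apply, Fin.sum_univ_succ]
      · linear_combination (-t) * hc
      · linear_combination t * hc
      · linear_combination k * hc - x * hk
      · linear_combination (-t) * hc
      · linear_combination t * hc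
      · linear_combination k * hc - x * hk
      · linear_combination -hc
      · linear_combination hc

theorem exists_root_of_monic_cubic (a b c : ℝ) : ∃ x : ℝ, x ^ 3 + a * x ^ 2 + b * x + c = 0 := by
  -- At `±M` the cubic term dominates the others, so the polynomial changes sign on `[-M, M]`.
  set M := 1 + |a| + |b| + |c|
  have ha := abs_le.1 (le_refl |a|)
  have hb := abs_le.1 (le_refl |b|)
  have hc := abs_le.1 (le_refl |c|)
  have h0a := abs_nonneg a
  have h0b := abs_nonneg b
  have h0c := abs_nonneg c
  have hM : 1 ≤ M := by linarith
  have hM2 : M ≤ M ^ 2 := by nlinarith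
  have hM1 : 1 ≤ M ^ 2 := hM.trans hM2
  have e : M ^ 3 = (1 + |a| + |b| + |c|) * M ^ 2 := by ring
  have t1 : |a * M ^ 2| = |a| * M ^ 2 := by rw [abs_mul, abs_of_nonneg (sq_nonneg M)]
  have t2 : |b * M| ≤ |b| * M ^ 2 := by
    rw [abs_mul, abs_of_nonneg (show 0 ≤ M by linarith)]
    exact mul_le_mul_of_nonneg_left hM2 h0b
  have t3 : |c| ≤ |c| * M ^ 2 := le_mul_of_one_le_right h0c hM1
  have k1 := abs_le.1 (le_of_eq t1)
  have k2 := abs_le.1 t2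
  have k3 := abs_le.1 t3
  have hcont : Continuous fun x : ℝ => x ^ 3 + a * x ^ 2 + b * x + c := by fun_prop
  have := intermediate_value_Icc (by linarith : -M ≤ M) hcont.continuousOn
  obtain ⟨x, -, hx⟩ := this (show (0 : ℝ) ∈ Set.Icc _ _ by
    constructor
    · have : (-M) ^ 3 + a * (-M) ^ 2 + b * (-M) + c = -M ^ 3 + a * M ^ 2 - b * M + c := by ring
      rw [this]
      linarith
    · linarith)
  exact ⟨x, hx⟩

theorem exists_real_eigenvector (T : Matrix (Fin 3) (Fin 3) ℝ) :
    ∃ (v : Fin 3 → ℝ) (l : ℝ), v ≠ 0 ∧ T *ᵥ v = l • v := by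
  obtain ⟨l, hl⟩ := exists_root_of_monic_cubic (-(T 0 0 + T 1 1 + T 2 2))
    (T 0 0 * T 1 1 - T 0 1 * T 1 0 + (T 0 0 * T 2 2 - T 0 2 * T 2 0)
      + (T 1 1 * T 2 2 - T 1 2 * T 2 1)) (-T.det)
  have hdet : (T - l • (1 : Matrix (Fin 3) (Fin 3) ℝ)).det = 0 := by
    rw [Matrix.det_fin_three] at hl ⊢
    simp
    linear_combination -hl
  obtain ⟨v, hv, h⟩ := Matrix.exists_mulVec_eq_zero_iff.2 hdet
  refine ⟨v, l, hv, ?_⟩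
  rwa [Matrix.sub_mulVec, Matrix.smul_mulVec, Matrix.one_mulVec, sub_eq_zero] at h

/-- Self-adjoint operators of a Lorentzian three-space have one of the four normal forms. -/
theorem exists_normalForm {T : Matrix (Fin 3) (Fin 3) ℝ} (hT : IsLorentzSelfAdjoint T) :
    ∃ S, IsNormalForm S ∧ LorentzConj T S := by
  obtain ⟨v, l, hv, h⟩ := exists_real_eigenvector T
  have hscale : ∀ k : ℝ, T *ᵥ (k • v) = l • (k • v) := fun k => by
    rw [Matrix.mulVec_smul, h, smul_comm]
  have hvec : ∀ k : ℝ, k • v = ![k * v 0, k * v 1, k * v 2] := fun k => by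
    ext i; fin_cases i <;> simp
  rcases lt_trichotomy (-v 0 ^ 2 + v 1 ^ 2 + v 2 ^ 2) 0 with hn | hn | hn
  · have hr : 0 < √(v 0 ^ 2 - v 1 ^ 2 - v 2 ^ 2) := Real.sqrt_pos.2 (by linarith)
    have hr2 := Real.sq_sqrt (show 0 ≤ v 0 ^ 2 - v 1 ^ 2 - v 2 ^ 2 by linarith)
    set R := √(v 0 ^ 2 - v 1 ^ 2 - v 2 ^ 2)
    have hs := hscale R⁻¹
    rw [hvec] at hs
    refine exists_normalForm_of_timelike hT ?_ hs
    field_simp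
    linarith
  · have hv0 : v 0 ≠ 0 := by
      intro h0
      apply hv
      have h1 : v 1 = 0 := by rw [h0] at hn; nlinarith [sq_nonneg (v 1), sq_nonneg (v 2)]
      have h2 : v 2 = 0 := by rw [h0] at hn; nlinarith [sq_nonneg (v 1), sq_nonneg (v 2)]
      ext i; fin_cases i <;> simp [h0, h1, h2]
    have hs := hscale (v 0)⁻¹
    rw [hvec, inv_mul_cancel₀ hv0] at hs
    refine exists_normalForm_of_null hT ?_ hs
    field_simp
    linarith
  · have hr : 0 < √(-v 0 ^ 2 + v 1 ^ 2 + v 2 ^ 2) := Real.sqrt_pos.2 hn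
    have hr2 := Real.sq_sqrt hn.le
    set R := √(-v 0 ^ 2 + v 1 ^ 2 + v 2 ^ 2)
    have hs := hscale R⁻¹
    rw [hvec] at hs
    refine exists_normalForm_of_spacelike hT ?_ hs
    field_simp
    linarith

end NormalForms

/-! ### Symmetries of the curvature tensor -/

section Symmetries

/-- The symmetries of a curvature tensor that involve pairs of slots. -/
structure FourTensor.IsCurvatureLike {V : Type*} [AddCommGroup V] [Module ℝ V]
    (A : FourTensor V) : Prop where
  antisymm_left (x y z v : V) : A x y z v = -A y x z v
  antisymm_right (x y z v : V) : A x y z v = -A x y v z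
  pair_symm (x y z v : V) : A x y z v = A z v x y

theorem FourTensor.IsCurvatureLike.pullback {V V' : Type*} [AddCommGroup V] [Module ℝ V]
    [AddCommGroup V'] [Module ℝ V'] {A : FourTensor V'} (hA : A.IsCurvatureLike)
    (T : V →ₗ[ℝ] V') : (A.pullback T).IsCurvatureLike where
  antisymm_left _ _ _ _ := hA.antisymm_left _ _ _ _
  antisymm_right _ _ _ _ := hA.antisymm_right _ _ _ _
  pair_symm _ _ _ _ := hA.pair_symm _ _ _ _

/-! ### Symmetries of the Weyl tensor -/

section Weyl

variable {V : Type*} [AddCommGroup V] [Module ℝ V]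

theorem kulkarniNomizu_apply (h k : LinearMap.BilinForm ℝ V) (v₁ v₂ v₃ v₄ : V) :
    kulkarniNomizu h k v₁ v₂ v₃ v₄ =
      h v₁ v₃ * k v₂ v₄ + h v₂ v₄ * k v₁ v₃ - h v₁ v₄ * k v₂ v₃ - h v₂ v₃ * k v₁ v₄ := rfl

theorem isCurvatureLike_kulkarniNomizu {h k : LinearMap.BilinForm ℝ V}
    (hh : ∀ x y, h x y = h y x) (hk : ∀ x y, k x y = k y x) :
    (kulkarniNomizu h k).IsCurvatureLike where
  antisymm_left x y z v := by simp only [kulkarniNomizu_apply]; ring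
  antisymm_right x y z v := by simp only [kulkarniNomizu_apply]; ring
  pair_symm x y z v := by
    simp only [kulkarniNomizu_apply]
    rw [hh z x, hh v y, hh z y, hh v x, hk z x, hk v y, hk z y, hk v x]
    ring

theorem slotsOneThree_apply (A : FourTensor V) (x y z v : V) :
    slotsOneThree A y v x z = A x y z v := rfl

variable [FiniteDimensional ℝ V]

/-- Coordinates in a pseudo-orthonormal basis are `εᵢ g(w, eᵢ)`. The formula yields the symmetry of
the Ricci tensor here and the smoothness of contractions later. -/
theorem metricContraction_eq_sum (g : LinearMap.BilinForm ℝ V) (hg : g.Nondegenerate)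
    (h : LinearMap.BilinForm ℝ V) (e : Module.Basis (Fin 4) ℝ V) (he : IsPseudoOrthonormal g e) :
    metricContraction g hg h = ∑ i, neutralSign i * h (e i) (e i) := by
  rw [metricContraction, LinearMap.trace_eq_matrix_trace ℝ e, Matrix.trace]
  refine Finset.sum_congr rfl fun i _ => ?_
  rw [Matrix.diag_apply, LinearMap.toMatrix_apply]
  set w := ((g.toDual hg).symm.toLinearMap ∘ₗ h) (e i) with hw
  have h1 : g w (e i) = h (e i) (e i) := by simp [hw]
  rw [← h1]
  have h2 : g w (e i) = ∑ j, e.repr w j * g (e j) (e i) := by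
    have h3 : g w (e i) = g (∑ j, e.repr w j • e j) (e i) := by rw [e.sum_repr]
    rw [h3, map_sum, LinearMap.sum_apply]
    simp
  have he' : ∀ i j, g (e i) (e j) = if i = j then neutralSign i else 0 := he
  rw [h2]
  simp only [he', mul_ite, mul_zero, Finset.sum_ite_eq', Finset.mem_univ, if_true]
  have h3 : neutralSign i * neutralSign i = 1 := by fin_cases i <;> simp [neutralSign]
  linear_combination (-(e.repr w i)) * h3

theorem ricciTensor_apply (g : LinearMap.BilinForm ℝ V) (hg : g.Nondegenerate) (A : FourTensor V)
    (y v : V) : ricciTensor g hg A y v = metricContraction g hg (slotsOneThree A y v) := rfl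

theorem isCurvatureLike_weylTensor {g : LinearMap.BilinForm ℝ V} (hg : g.Nondegenerate)
    (hsymm : ∀ x y, g x y = g y x) {e : Module.Basis (Fin 4) ℝ V} (he : IsPseudoOrthonormal g e)
    {A : FourTensor V} (hA : A.IsCurvatureLike) : (weylTensor g hg A).IsCurvatureLike := by
  have hric : ∀ x y, ricciTensor g hg A x y = ricciTensor g hg A y x := fun x y => by
    simp only [ricciTensor_apply, metricContraction_eq_sum g hg _ e he, slotsOneThree_apply]
    exact Finset.sum_congr rfl fun i _ => by rw [hA.pair_symm]
  have h1 := isCurvatureLike_kulkarniNomizu hsymm hsymm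
  have h2 : (kulkarniNomizu (ricciTensor g hg A - (scalarCurvature g hg A / 4) • g)
      g).IsCurvatureLike :=
    isCurvatureLike_kulkarniNomizu (fun x y => by simp [hric x y, hsymm x y]) hsymm
  constructor <;> intro x y z v <;>
    simp only [weylTensor, LinearMap.sub_apply, LinearMap.smul_apply, smul_eq_mul]
  · rw [hA.antisymm_left, h1.antisymm_left, h2.antisymm_left]; ring
  · rw [hA.antisymm_right, h1.antisymm_right, h2.antisymm_right]; ring
  · rw [hA.pair_symm, h1.pair_symm, h2.pair_symm]

end Weyl

/-! ### Symmetries of the curvature of a coordinate metric -/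

section Coordinates

variable {E : Type*} [NormedAddCommGroup E] [NormedSpace ℝ E]

/-- `G` is a smooth metric near `u`. -/
structure IsSmoothMetricAt (G : E → E →L[ℝ] E →L[ℝ] ℝ) (u : E) : Prop where
  contDiffAt : ContDiffAt ℝ ∞ G u
  symm : ∀ᶠ u' in 𝓝 u, ∀ v w, G u' v w = G u' w v
  isInvertible : ∀ᶠ u' in 𝓝 u, (G u').IsInvertible

variable {G : E → E →L[ℝ] E →L[ℝ] ℝ} {u : E}

theorem metric_christoffel (h : (G u).IsInvertible) (v w z : E) :
    G u (christoffel G u v w) z = christoffelFirst G u v w z := by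
  obtain ⟨e, he⟩ := h
  simp [christoffel, ← he]

theorem coordRiemann_apply (G : E → E →L[ℝ] E →L[ℝ] ℝ) (u x y z v : E) :
    coordRiemann G u x y z v = G u (coordCurvature G u x y z) v := rfl

theorem IsSmoothMetricAt.fderiv_symm (h : IsSmoothMetricAt G u) :
    ∀ᶠ u' in 𝓝 u, ∀ x v w, fderiv ℝ G u' x v w = fderiv ℝ G u' x w v := by
  filter_upwards [h.symm.eventually_nhds] with u' hu' x v w
  let F := (ContinuousLinearMap.flipₗᵢ ℝ E E ℝ).toContinuousLinearEquiv
  have h1 : G =ᶠ[𝓝 u'] F ∘ G := by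
    filter_upwards [hu'] with p hp
    ext v w
    exact hp v w
  have h2 : fderiv ℝ G u' = (F : _ →L[ℝ] _) ∘L fderiv ℝ G u' := by
    conv_lhs => rw [h1.fderiv_eq, F.comp_fderiv]
  exact congrArg (fun L => L x v w) h2

theorem IsSmoothMetricAt.hasFDerivAt_fderiv (h : IsSmoothMetricAt G u) :
    HasFDerivAt (fderiv ℝ G) (fderiv ℝ (fderiv ℝ G) u) u :=
  ((h.contDiffAt.fderiv_right (m := ∞) (by simp)).differentiableAt (by simp)).hasFDerivAt

theorem IsSmoothMetricAt.hasFDerivAt_fderiv_apply (h : IsSmoothMetricAt G u) (x v w : E) :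
    ∃ L : E →L[ℝ] ℝ, HasFDerivAt (fun u => fderiv ℝ G u x v w) L u ∧
      ∀ y, L y = fderiv ℝ (fderiv ℝ G) u y x v w :=
  ⟨_, ((h.hasFDerivAt_fderiv.clm_apply (hasFDerivAt_const x u)).clm_apply
    (hasFDerivAt_const v u)).clm_apply (hasFDerivAt_const w u), fun y => by simp⟩

theorem IsSmoothMetricAt.fderiv_fderiv_symm (h : IsSmoothMetricAt G u) (x y v w : E) :
    fderiv ℝ (fderiv ℝ G) u x y v w = fderiv ℝ (fderiv ℝ G) u x y w v := by
  obtain ⟨L, hL, hL'⟩ := h.hasFDerivAt_fderiv_apply y v w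
  obtain ⟨L', hL2, hL2'⟩ := h.hasFDerivAt_fderiv_apply y w v
  rw [← hL', ← hL2']
  congr 1
  refine hL.unique (hL2.congr_of_eventuallyEq ?_)
  filter_upwards [h.fderiv_symm] with u' hu' using hu' y v w

theorem IsSmoothMetricAt.fderiv_fderiv_comm (h : IsSmoothMetricAt G u) (x y : E) :
    fderiv ℝ (fderiv ℝ G) u x y = fderiv ℝ (fderiv ℝ G) u y x :=
  (h.contDiffAt.isSymmSndFDerivAt (by simp; exact ENat.LEInfty.out)).eq x y

theorem IsSmoothMetricAt.hasFDerivAt_christoffelFirst_apply (h : IsSmoothMetricAt G u)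
    (x z v : E) : ∃ L : E →L[ℝ] ℝ, HasFDerivAt (fun u => christoffelFirst G u x z v) L u ∧
      ∀ y, L y = 1 / 2 * (fderiv ℝ (fderiv ℝ G) u y x z v + fderiv ℝ (fderiv ℝ G) u y z x v
        - fderiv ℝ (fderiv ℝ G) u y v x z) := by
  obtain ⟨L₁, h1, e1⟩ := h.hasFDerivAt_fderiv_apply x z v
  obtain ⟨L₂, h2, e2⟩ := h.hasFDerivAt_fderiv_apply z x v
  obtain ⟨L₃, h3, e3⟩ := h.hasFDerivAt_fderiv_apply v x z
  refine ⟨(1 / 2 : ℝ) • (L₁ + L₂ - L₃), ?_, fun y => by simp [e1, e2, e3]⟩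
  simp only [christoffelFirst_apply]
  exact ((h1.add h2).sub h3).const_mul _

theorem IsSmoothMetricAt.contDiffAt_christoffelFirst (h : IsSmoothMetricAt G u) :
    ContDiffAt ℝ ∞ (christoffelFirst G) u := by
  have h1 : ContDiffAt ℝ ∞ (fderiv ℝ G) u := h.contDiffAt.fderiv_right (by simp)
  have h2 : ContDiffAt ℝ ∞ (fun u => (fderiv ℝ G u).flip) u :=
    (ContinuousLinearMap.flipₗᵢ ℝ E E
      (E →L[ℝ] ℝ)).toContinuousLinearEquiv.contDiff.contDiffAt.comp u h1
  have h3 : ContDiffAt ℝ ∞ (fun u => fderiv ℝ G u + (fderiv ℝ G u).flip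
      - (ContinuousLinearMap.flipₗᵢ ℝ E E ℝ).toContinuousLinearEquiv.toContinuousLinearMap ∘L
        (fderiv ℝ G u).flip) u := (h1.add h2).sub (contDiffAt_const.clm_comp h2)
  exact (contDiffAt_const (c := (1 / 2 : ℝ))).smul h3

variable [FiniteDimensional ℝ E]

theorem IsSmoothMetricAt.contDiffAt_christoffel (h : IsSmoothMetricAt G u) :
    ContDiffAt ℝ ∞ (christoffel G) u := by
  have : CompleteSpace E := FiniteDimensional.complete ℝ E
  have h1 : ContDiffAt ℝ ∞ (fun u => (G u).inverse) u :=
    (h.isInvertible.self_of_nhds.contDiffAt_map_inverse).comp u h.contDiffAt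
  have h2 : ContDiffAt ℝ ∞ (fun u => ContinuousLinearMap.compL ℝ E (E →L[ℝ] ℝ) E (G u).inverse) u :=
    (ContinuousLinearMap.compL ℝ E (E →L[ℝ] ℝ) E).contDiff.contDiffAt.comp u h1
  exact h2.clm_comp h.contDiffAt_christoffelFirst

theorem IsSmoothMetricAt.contDiffAt_coordCurvature (h : IsSmoothMetricAt G u) {x y z : E → E}
    (hx : ContDiffAt ℝ ∞ x u) (hy : ContDiffAt ℝ ∞ y u) (hz : ContDiffAt ℝ ∞ z u) :
    ContDiffAt ℝ ∞ (fun u => coordCurvature G u (x u) (y u) (z u)) u := by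
  have h1 := h.contDiffAt_christoffel
  have h2 : ContDiffAt ℝ ∞ (fderiv ℝ (christoffel G)) u := h1.fderiv_right (by simp)
  have h3 : ContDiffAt ℝ ∞ (fun u => coordCurvature G u (x u) (y u)) u :=
    ((((h2.clm_apply hy).clm_apply hx).sub ((h2.clm_apply hx).clm_apply hy)).add
      ((h1.clm_apply hy).clm_comp (h1.clm_apply hx))).sub
      ((h1.clm_apply hx).clm_comp (h1.clm_apply hy))
  exact h3.clm_apply hz

/-- The derivative of the identity that defines the Christoffel symbols. -/
theorem IsSmoothMetricAt.metric_fderiv_christoffel (h : IsSmoothMetricAt G u) (y x z v : E) :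
    G u (fderiv ℝ (christoffel G) u y x z) v =
      1 / 2 * (fderiv ℝ (fderiv ℝ G) u y x z v + fderiv ℝ (fderiv ℝ G) u y z x v
        - fderiv ℝ (fderiv ℝ G) u y v x z) - fderiv ℝ G u y (christoffel G u x z) v := by
  have h1 := (h.contDiffAt_christoffel.differentiableAt (by simp)).hasFDerivAt
  have h2 := (h.contDiffAt.differentiableAt (by simp)).hasFDerivAt
  have h3 := (h1.clm_apply (hasFDerivAt_const x u)).clm_apply (hasFDerivAt_const z u)
  have h4 := (h2.clm_apply h3).clm_apply (hasFDerivAt_const v u)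
  obtain ⟨L, hL, hL'⟩ := h.hasFDerivAt_christoffelFirst_apply x z v
  have h5 := h4.unique (hL.congr_of_eventuallyEq (by
    filter_upwards [h.isInvertible] with u' hu' using metric_christoffel hu' x z v))
  have h6 := congrArg (fun L => L y) h5
  simp only [hL'] at h6
  simp at h6
  linarith

/-- Metric compatibility, `Γ(y, w; v) + Γ(y, v; w) = ∂_y G(w, v)`, turns the terms left from
differentiating `Γ` into products of two Christoffel symbols. In this form the symmetries can be
read off from those of the second derivatives of `G` and of `Γ`. -/
theorem IsSmoothMetricAt.coordRiemann_eq (h : IsSmoothMetricAt G u) (x y z v : E) :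
    coordRiemann G u x y z v =
      1 / 2 * (fderiv ℝ (fderiv ℝ G) u y z x v - fderiv ℝ (fderiv ℝ G) u y v x z
        - fderiv ℝ (fderiv ℝ G) u x z y v + fderiv ℝ (fderiv ℝ G) u x v y z)
      - G u (christoffel G u y v) (christoffel G u x z)
      + G u (christoffel G u x v) (christoffel G u y z) := by
  have hinv := h.isInvertible.self_of_nhds
  have hs := h.fderiv_symm.self_of_nhds
  rw [coordRiemann_apply, metric_christoffel hinv, metric_christoffel hinv]
  have e : G u (coordCurvature G u x y z) v = G u (fderiv ℝ (christoffel G) u y x z) v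
      - G u (fderiv ℝ (christoffel G) u x y z) v
      + G u (christoffel G u y (christoffel G u x z)) v
      - G u (christoffel G u x (christoffel G u y z)) v := by simp [coordCurvature]
  rw [e, metric_christoffel hinv, metric_christoffel hinv, h.metric_fderiv_christoffel,
    h.metric_fderiv_christoffel, h.fderiv_fderiv_comm x y]
  simp only [christoffelFirst_apply]
  rw [hs y (christoffel G u x z) v, hs x (christoffel G u y z) v]
  linarith [hs (christoffel G u x z) y v, hs (christoffel G u y z) x v,
    hs v (christoffel G u x z) y, hs v (christoffel G u y z) x]

theorem IsSmoothMetricAt.isCurvatureLike_coordRiemann (h : IsSmoothMetricAt G u) :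
    (coordRiemann G u).IsCurvatureLike := by
  have hs := h.symm.self_of_nhds
  have hc : ∀ x z, christoffel G u x z = christoffel G u z x := fun x z => by
    have hsd := h.fderiv_symm.self_of_nhds
    obtain ⟨e, he⟩ := h.isInvertible.self_of_nhds
    apply e.injective
    ext v
    have h1 := metric_christoffel h.isInvertible.self_of_nhds x z v
    have h2 := metric_christoffel h.isInvertible.self_of_nhds z x v
    rw [christoffelFirst_apply] at h1 h2
    rw [← he] at h1 h2
    change e _ v = e _ v
    have h3 := hsd v x z
    rw [← ContinuousLinearEquiv.coe_coe, h1, h2]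
    linarith
  constructor <;> intro x y z v
  · rw [h.coordRiemann_eq, h.coordRiemann_eq]; ring
  · rw [h.coordRiemann_eq, h.coordRiemann_eq, hs (christoffel G u y v)]
    rw [hs (christoffel G u x v)]; ring
  · rw [h.coordRiemann_eq, h.coordRiemann_eq, h.fderiv_fderiv_comm v x,
      h.fderiv_fderiv_comm v y, h.fderiv_fderiv_comm z x, h.fderiv_fderiv_comm z y,
      h.fderiv_fderiv_symm y z x v, h.fderiv_fderiv_symm y v x z, h.fderiv_fderiv_symm x z y v,
      h.fderiv_fderiv_symm x v y z, hc y v, hc x z, hc x v, hc y z, hs (christoffel G u z y)]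
    ring

end Coordinates

end Symmetries

/-! ### Naturality of the curvature tensor -/

section Naturality

variable {E : Type*} [NormedAddCommGroup E] [NormedSpace ℝ E]

/-- Near `u`, the metric `G'` is the pull-back of the metric `G` under the smooth map `ψ`. -/
structure IsMetricPullbackAt (G' G : E → E →L[ℝ] E →L[ℝ] ℝ) (ψ : E → E) (u : E) : Prop where
  contDiffAt : ContDiffAt ℝ ∞ ψ u
  source : IsSmoothMetricAt G' u
  target : IsSmoothMetricAt G (ψ u)
  eq : ∀ᶠ u' in 𝓝 u, ∀ v w, G' u' v w = G (ψ u') (fderiv ℝ ψ u' v) (fderiv ℝ ψ u' w)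

namespace IsMetricPullbackAt

variable {G' G : E → E →L[ℝ] E →L[ℝ] ℝ} {ψ : E → E} {u : E}

theorem hasFDerivAt_fderiv (h : IsMetricPullbackAt G' G ψ u) :
    HasFDerivAt (fderiv ℝ ψ) (fderiv ℝ (fderiv ℝ ψ) u) u :=
  ((h.contDiffAt.fderiv_right (m := ∞) (by simp)).differentiableAt (by simp)).hasFDerivAt

theorem fderiv_fderiv_comm (h : IsMetricPullbackAt G' G ψ u) (x y : E) :
    fderiv ℝ (fderiv ℝ ψ) u x y = fderiv ℝ (fderiv ℝ ψ) u y x :=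
  (h.contDiffAt.isSymmSndFDerivAt (by simp; exact ENat.LEInfty.out)).eq x y

theorem fderiv_eq (h : IsMetricPullbackAt G' G ψ u) (x v w : E) :
    fderiv ℝ G' u x v w =
      fderiv ℝ G (ψ u) (fderiv ℝ ψ u x) (fderiv ℝ ψ u v) (fderiv ℝ ψ u w)
      + G (ψ u) (fderiv ℝ (fderiv ℝ ψ) u x v) (fderiv ℝ ψ u w)
      + G (ψ u) (fderiv ℝ ψ u v) (fderiv ℝ (fderiv ℝ ψ) u x w) := by
  have h1 := (h.source.contDiffAt.differentiableAt (by simp)).hasFDerivAt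
  have h2 := (h.target.contDiffAt.differentiableAt (by simp)).hasFDerivAt
  have h3 := (h.contDiffAt.differentiableAt (by simp)).hasFDerivAt
  have h4 := h2.comp u h3
  have h5 := h.hasFDerivAt_fderiv
  have l := (h1.clm_apply (hasFDerivAt_const v u)).clm_apply (hasFDerivAt_const w u)
  have r := (h4.clm_apply (h5.clm_apply (hasFDerivAt_const v u))).clm_apply
    (h5.clm_apply (hasFDerivAt_const w u))
  have e := congrArg (fun L => L x) (l.unique (r.congr_of_eventuallyEq (by
    filter_upwards [h.eq] with u' hu' using hu' v w)))
  simp at e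
  rw [e]
  ring

/-- A kernel vector of `Dψ` would lie in the radical of the nondegenerate metric `G'`. Surjectivity
allows identities to be tested against vectors `Dψ z` only. -/
theorem surjective_fderiv [FiniteDimensional ℝ E] (h : IsMetricPullbackAt G' G ψ u) :
    Function.Surjective (fderiv ℝ ψ u) := by
  refine LinearMap.surjective_of_injective (f := (fderiv ℝ ψ u : E →ₗ[ℝ] E)) ?_
  rw [injective_iff_map_eq_zero]
  intro v hv
  obtain ⟨e, he⟩ := h.source.isInvertible.self_of_nhds
  apply e.injective
  rw [map_zero]
  ext w
  have := h.eq.self_of_nhds v w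
  have hv' : fderiv ℝ ψ u v = 0 := hv
  rw [hv', map_zero, ← he] at this
  exact this

/-- In the Koszul combination of the derivatives of the pulled-back metric, all second derivatives
of `ψ` cancel except two copies of `G (D²ψ(v, w), Dψ z)`. -/
theorem fderiv_christoffel [FiniteDimensional ℝ E] (h : IsMetricPullbackAt G' G ψ u) (v w : E) :
    fderiv ℝ ψ u (christoffel G' u v w) = fderiv ℝ (fderiv ℝ ψ) u v w
      + christoffel G (ψ u) (fderiv ℝ ψ u v) (fderiv ℝ ψ u w) := by
  have hinv := h.target.isInvertible.self_of_nhds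
  have hs := h.target.symm.self_of_nhds
  have hinv' := hinv
  obtain ⟨e, he⟩ := hinv'
  apply e.injective
  ext z'
  obtain ⟨z, rfl⟩ := h.surjective_fderiv z'
  change (e : E →L[ℝ] E →L[ℝ] ℝ) _ _ = (e : E →L[ℝ] E →L[ℝ] ℝ) _ _
  rw [he, ← h.eq.self_of_nhds, metric_christoffel h.source.isInvertible.self_of_nhds, map_add,
    add_apply, metric_christoffel hinv, christoffelFirst_apply,
    christoffelFirst_apply, h.fderiv_eq, h.fderiv_eq, h.fderiv_eq, h.fderiv_fderiv_comm w v,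
    h.fderiv_fderiv_comm z v, h.fderiv_fderiv_comm z w,
    hs (fderiv ℝ (fderiv ℝ ψ) u v z)]
  ring

/-- The derivative of the transformation law of the Christoffel symbols. -/
theorem fderiv_fderiv_christoffel [FiniteDimensional ℝ E]
    (h : ∀ᶠ u' in 𝓝 u, IsMetricPullbackAt G' G ψ u') (x y z : E) :
    fderiv ℝ ψ u (fderiv ℝ (christoffel G') u x y z) =
      fderiv ℝ (fderiv ℝ (fderiv ℝ ψ)) u x y z
      + fderiv ℝ (christoffel G) (ψ u) (fderiv ℝ ψ u x) (fderiv ℝ ψ u y) (fderiv ℝ ψ u z)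
      + christoffel G (ψ u) (fderiv ℝ (fderiv ℝ ψ) u x y) (fderiv ℝ ψ u z)
      + christoffel G (ψ u) (fderiv ℝ ψ u y) (fderiv ℝ (fderiv ℝ ψ) u x z)
      - fderiv ℝ (fderiv ℝ ψ) u x (christoffel G' u y z) := by
  have h0 := h.self_of_nhds
  have h1 := (h0.source.contDiffAt_christoffel.differentiableAt (by simp)).hasFDerivAt
  have h2 := (h0.target.contDiffAt_christoffel.differentiableAt (by simp)).hasFDerivAt
  have h3 := (h0.contDiffAt.differentiableAt (by simp)).hasFDerivAt
  have h4 := h2.comp u h3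
  have h5 := h0.hasFDerivAt_fderiv
  have h6 : HasFDerivAt (fderiv ℝ (fderiv ℝ ψ)) (fderiv ℝ (fderiv ℝ (fderiv ℝ ψ)) u) u :=
    (((h0.contDiffAt.fderiv_right (m := ∞) (by simp)).fderiv_right (m := ∞)
      (by simp)).differentiableAt (by simp)).hasFDerivAt
  have l := h5.clm_apply ((h1.clm_apply (hasFDerivAt_const y u)).clm_apply (hasFDerivAt_const z u))
  have r := ((h6.clm_apply (hasFDerivAt_const y u)).clm_apply (hasFDerivAt_const z u)).add
    ((h4.clm_apply (h5.clm_apply (hasFDerivAt_const y u))).clm_apply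
      (h5.clm_apply (hasFDerivAt_const z u)))
  have e := congrArg (fun L => L x) (l.unique (r.congr_of_eventuallyEq (by
    filter_upwards [h] with u' hu' using hu'.fderiv_christoffel y z)))
  simp at e
  rw [eq_sub_iff_add_eq, e]
  abel

/-- After antisymmetrisation in `x` and `y` the third derivative of `ψ` drops out by symmetry, and
the terms with its second derivative cancel in pairs. The pull-back relation is needed near `u`, as
the law for `Γ` is differentiated. -/
theorem fderiv_coordCurvature [FiniteDimensional ℝ E]
    (h : ∀ᶠ u' in 𝓝 u, IsMetricPullbackAt G' G ψ u') (x y z : E) :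
    fderiv ℝ ψ u (coordCurvature G' u x y z) =
      coordCurvature G (ψ u) (fderiv ℝ ψ u x) (fderiv ℝ ψ u y) (fderiv ℝ ψ u z) := by
  have h0 := h.self_of_nhds
  have h3 : fderiv ℝ (fderiv ℝ (fderiv ℝ ψ)) u x y = fderiv ℝ (fderiv ℝ (fderiv ℝ ψ)) u y x :=
    ((h0.contDiffAt.fderiv_right (m := ∞) (by simp)).isSymmSndFDerivAt
      (by simp; exact ENat.LEInfty.out)).eq x y
  simp only [coordCurvature, add_apply, sub_apply,
    ContinuousLinearMap.comp_apply, map_add, map_sub, fderiv_fderiv_christoffel h,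
    h0.fderiv_christoffel, h3, h0.fderiv_fderiv_comm y x]
  abel

/-- The curvature tensor of the pull-back of a metric is the pull-back of the curvature tensor. -/
theorem coordRiemann_eq [FiniteDimensional ℝ E]
    (h : ∀ᶠ u' in 𝓝 u, IsMetricPullbackAt G' G ψ u') (x y z v : E) :
    coordRiemann G' u x y z v =
      coordRiemann G (ψ u) (fderiv ℝ ψ u x) (fderiv ℝ ψ u y) (fderiv ℝ ψ u z)
        (fderiv ℝ ψ u v) := by
  rw [coordRiemann_apply, h.self_of_nhds.eq.self_of_nhds, fderiv_coordCurvature h,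
    coordRiemann_apply]

end IsMetricPullbackAt

end Naturality

/-! ### Jacobi operators in pseudo-orthonormal frames -/

section Frames

variable {V : Type*} [AddCommGroup V] [Module ℝ V]

theorem neutralSign_mul_self (i : Fin 4) : neutralSign i * neutralSign i = 1 := by
  fin_cases i <;> simp [neutralSign]

/-- The Gram matrix of signature `(-, -, +, +)`. -/
def neutralGram : Matrix (Fin 4) (Fin 4) ℝ := Matrix.diagonal neutralSign

theorem neutralGram_mul_self : neutralGram * neutralGram = 1 := by
  rw [neutralGram, Matrix.diagonal_mul_diagonal, ← Matrix.diagonal_one]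
  exact congrArg _ (funext neutralSign_mul_self)

theorem IsPseudoOrthonormal.apply_sum {g : LinearMap.BilinForm ℝ V} {e : Fin 4 → V}
    (he : IsPseudoOrthonormal g e) (c : Fin 4 → ℝ) (j : Fin 4) :
    g (∑ i, c i • e i) (e j) = c j * neutralSign j := by
  have he' : ∀ i j, g (e i) (e j) = if i = j then neutralSign i else 0 := he
  rw [map_sum, LinearMap.sum_apply]
  simp [he']

theorem IsPseudoOrthonormal.exists_basis {g : LinearMap.BilinForm ℝ V} {e : Fin 4 → V}
    (he : IsPseudoOrthonormal g e) (hV : Module.finrank ℝ V = 4) :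
    ∃ b : Module.Basis (Fin 4) ℝ V, ⇑b = e := by
  have hli : LinearIndependent ℝ e := by
    rw [Fintype.linearIndependent_iff]
    intro c hc i
    have h1 := he.apply_sum c i
    rw [hc, map_zero, LinearMap.zero_apply] at h1
    have h2 := neutralSign_mul_self i
    linear_combination (-neutralSign i) * h1 - c i * h2
  exact ⟨basisOfLinearIndependentOfCardEqFinrank hli (by simp [hV]), by simp⟩

theorem IsPseudoOrthonormal.repr_eq {g : LinearMap.BilinForm ℝ V} {b : Module.Basis (Fin 4) ℝ V}
    (hb : IsPseudoOrthonormal g b) (v : V) (i : Fin 4) :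
    b.repr v i = neutralSign i * g v (b i) := by
  have h1 := hb.apply_sum (b.repr v) i
  rw [b.sum_repr] at h1
  linear_combination (-neutralSign i) * h1 - b.repr v i * neutralSign_mul_self i

/-- The matrix of the Jacobi operator `J_A(e₁)` in the pseudo-orthonormal basis `e`. -/
def jacobiMatrix (A : FourTensor V) (e : Fin 4 → V) : Matrix (Fin 4) (Fin 4) ℝ :=
  Matrix.of fun i j => neutralSign i * A (e j) (e 0) (e 0) (e i)

theorem toMatrix_jacobiOperator [FiniteDimensional ℝ V] {g : LinearMap.BilinForm ℝ V}
    (hg : g.Nondegenerate) (A : FourTensor V) {b : Module.Basis (Fin 4) ℝ V}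
    (hb : IsPseudoOrthonormal g b) :
    LinearMap.toMatrix b b (jacobiOperator g hg A (b 0)) = jacobiMatrix A b := by
  ext i j
  rw [LinearMap.toMatrix_apply, hb.repr_eq, jacobiOperator_spec, jacobiMatrix, Matrix.of_apply]

theorem FourTensor.IsCurvatureLike.jacobiMatrix_zero {A : FourTensor V} (hA : A.IsCurvatureLike)
    (e : Fin 4 → V) (i : Fin 4) : jacobiMatrix A e 0 i = 0 ∧ jacobiMatrix A e i 0 = 0 := by
  have h1 : A (e i) (e 0) (e 0) (e 0) = 0 := by
    linarith [hA.antisymm_right (e i) (e 0) (e 0) (e 0)]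
  have h2 : A (e 0) (e 0) (e 0) (e i) = 0 := by
    linarith [hA.antisymm_left (e 0) (e 0) (e 0) (e i)]
  simp [jacobiMatrix, h1, h2]

theorem FourTensor.IsCurvatureLike.isLorentzSelfAdjoint {A : FourTensor V}
    (hA : A.IsCurvatureLike) (e : Fin 4 → V) :
    IsLorentzSelfAdjoint (lowerBlock (jacobiMatrix A e)) := by
  -- Pair symmetry followed by both antisymmetries; the Bianchi identity is not involved.
  have h : ∀ x y z, A y x x z = A z x x y := fun x y z => by
    rw [hA.pair_symm, hA.antisymm_left, hA.antisymm_right, neg_neg]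
  have hη : lorentzGram = Matrix.diagonal fun i : Fin 3 => neutralSign i.succ := by
    ext i j; fin_cases i <;> fin_cases j <;> simp [lorentzGram, neutralSign]
  rw [IsLorentzSelfAdjoint, hη]
  ext i j
  rw [Matrix.mul_diagonal, Matrix.diagonal_mul]
  simp only [lowerBlock, jacobiMatrix, Matrix.transpose_apply, Matrix.submatrix_apply,
    Matrix.of_apply]
  rw [h]
  linear_combination A (e j.succ) (e 0) (e 0) (e i.succ) *
    (neutralSign_mul_self j.succ - neutralSign_mul_self i.succ)

/-- A change of real basis is absorbed into the complex conjugating matrix, so the basis may be the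
given orthonormal frame. -/
theorem HasJordanNormalForm.exists_toMatrix_mul_eq [FiniteDimensional ℝ V] {T : V →ₗ[ℝ] V}
    {N : Matrix (Fin 4) (Fin 4) ℂ} (h : HasJordanNormalForm T N) (b : Module.Basis (Fin 4) ℝ V) :
    ∃ P : Matrix (Fin 4) (Fin 4) ℂ, IsUnit P ∧
      (LinearMap.toMatrix b b T).map (algebraMap ℝ ℂ) * P = P * N := by
  obtain ⟨-, d, P, hP, hPN⟩ := h
  have h1 : LinearMap.toMatrix b b T * b.toMatrix d = b.toMatrix d * LinearMap.toMatrix d d T := by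
    rw [linearMap_toMatrix_mul_basis_toMatrix, basis_toMatrix_mul_linearMap_toMatrix]
  have h2 : IsUnit (b.toMatrix d) := by
    rw [Matrix.isUnit_iff_isUnit_det]
    exact Matrix.isUnit_det_of_left_inverse (d.toMatrix_mul_toMatrix_flip b)
  refine ⟨(b.toMatrix d).map (algebraMap ℝ ℂ) * P, ?_, ?_⟩
  · exact (h2.map (algebraMap ℝ ℂ).mapMatrix).mul hP
  · rw [← mul_assoc, ← Matrix.map_mul, h1, Matrix.map_mul, mul_assoc, hPN, mul_assoc]

/-- Operators with a common Jordan normal form have similar matrices. -/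
theorem HasJordanNormalForm.exists_intertwiner {V' : Type*} [AddCommGroup V'] [Module ℝ V']
    [FiniteDimensional ℝ V] [FiniteDimensional ℝ V'] {T : V →ₗ[ℝ] V} {T' : V' →ₗ[ℝ] V'}
    {N : Matrix (Fin 4) (Fin 4) ℂ} (h : HasJordanNormalForm T N) (h' : HasJordanNormalForm T' N)
    (b : Module.Basis (Fin 4) ℝ V) (b' : Module.Basis (Fin 4) ℝ V') :
    ∃ Q : Matrix (Fin 4) (Fin 4) ℝ, IsUnit Q ∧
      LinearMap.toMatrix b b T * Q = Q * LinearMap.toMatrix b' b' T' := by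
  obtain ⟨P, hP, hPN⟩ := h.exists_toMatrix_mul_eq b
  obtain ⟨P', hP', hPN'⟩ := h'.exists_toMatrix_mul_eq b'
  obtain ⟨w, rfl⟩ := hP'
  refine exists_real_intertwiner (P := P * (↑w⁻¹ : Matrix (Fin 4) (Fin 4) ℂ))
    (hP.mul (Units.isUnit _)) ?_
  rw [← mul_assoc, hPN, mul_assoc, mul_assoc]
  congr 1
  rw [Units.eq_inv_mul_iff_mul_eq, ← mul_assoc, ← hPN', mul_assoc, Units.mul_inv, mul_one]

/-- The frame obtained from `e` by the change `M` of the last three vectors. -/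
def changeLastThree (M : Matrix (Fin 3) (Fin 3) ℝ) (e : Fin 4 → V) : Fin 4 → V :=
  Fin.cons (e 0) fun j => ∑ i : Fin 3, M i j • e i.succ

theorem IsPseudoOrthonormal.changeLastThree {g : LinearMap.BilinForm ℝ V} {e : Fin 4 → V}
    (he : IsPseudoOrthonormal g e) {M : Matrix (Fin 3) (Fin 3) ℝ}
    (hM : Mᵀ * lorentzGram * M = lorentzGram) :
    IsPseudoOrthonormal g (changeLastThree M e) := by
  have he' : ∀ i j, g (e i) (e j) = if i = j then neutralSign i else 0 := he
  have hη : lorentzGram = Matrix.diagonal fun i : Fin 3 => neutralSign i.succ := by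
    ext i j; fin_cases i <;> fin_cases j <;> simp [lorentzGram, neutralSign]
  intro i j
  refine Fin.cases ?_ (fun i => ?_) i <;> refine Fin.cases ?_ (fun j => ?_) j
  · simp [_root_.changeLastThree, he']
  · simp [_root_.changeLastThree, he', (Fin.succ_ne_zero _).symm]
  · simp [_root_.changeLastThree, he', map_sum, LinearMap.sum_apply]
  · have h := congrFun (congrFun hM i) j
    rw [hη, Matrix.mul_apply] at h
    simp only [Matrix.mul_diagonal, Matrix.transpose_apply, Matrix.diagonal_apply] at h
    simp only [_root_.changeLastThree, Fin.cons_succ, map_sum, LinearMap.sum_apply, map_smul,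
      LinearMap.smul_apply, he', smul_eq_mul, Fin.succ_inj, mul_ite, mul_zero,
      Finset.sum_ite_eq', Finset.mem_univ, if_true]
    rw [← h]
    exact Finset.sum_congr rfl fun k _ => by ring

/-- The vanishing top row of `J` keeps the images of the last three vectors in their span, so only
the lower block matters. -/
theorem isMatrixOnLastThree_changeLastThree {T : V →ₗ[ℝ] V} {b : Module.Basis (Fin 4) ℝ V}
    {J : Matrix (Fin 4) (Fin 4) ℝ} (hT : LinearMap.toMatrix b b T = J) (hJ : ∀ i, J 0 i = 0)
    {M L : Matrix (Fin 3) (Fin 3) ℝ} (hM : lowerBlock J * M = M * L) :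
    IsMatrixOnLastThree T (changeLastThree M b) L := by
  have h1 : ∀ j : Fin 3, T (b j.succ) = ∑ i : Fin 3, lowerBlock J i j • b i.succ := fun j => by
    have h2 : ∀ i, b.repr (T (b j.succ)) i = J i j.succ := fun i => by
      rw [← hT, LinearMap.toMatrix_apply]
    rw [← b.sum_repr (T (b j.succ)), Fin.sum_univ_succ]
    simp [h2, hJ, lowerBlock]
  intro j
  simp only [changeLastThree, Fin.cons_succ, map_sum, map_smul, h1, Finset.smul_sum, smul_smul]
  rw [Finset.sum_comm]
  conv_rhs => rw [Finset.sum_comm]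
  refine Finset.sum_congr rfl fun k _ => ?_
  rw [← Finset.sum_smul, ← Finset.sum_smul]
  congr 1
  have h3 := congrFun (congrFun hM k) j
  rw [Matrix.mul_apply, Matrix.mul_apply] at h3
  calc _ = ∑ i, lowerBlock J k i * M i j := Finset.sum_congr rfl fun i _ => by ring
    _ = ∑ i, M k i * L i j := h3
    _ = _ := Finset.sum_congr rfl fun i _ => by ring

end Frames

/-! ### Smooth frames and smooth reduction to normal form -/

section SmoothFrames

variable {E : Type*} [NormedAddCommGroup E] [NormedSpace ℝ E]

open scoped Matrix.Norms.Operator in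
theorem contDiffAt_matrix_iff {m n : Type*} [Fintype m] [Fintype n] [DecidableEq m] [DecidableEq n]
    {J : E → Matrix m n ℝ} {u : E} :
    ContDiffAt ℝ ∞ J u ↔ ∀ i j, ContDiffAt ℝ ∞ (fun u => J u i j) u := by
  constructor
  · intro h i j
    exact (LinearMap.toContinuousLinearMap
      (Matrix.entryLinearMap ℝ ℝ i j)).contDiff.contDiffAt.comp u h
  · intro h
    have : J = fun u => ∑ i, ∑ j, J u i j • Matrix.single i j (1 : ℝ) := by
      funext u
      conv_lhs => rw [Matrix.matrix_eq_sum_single (J u)]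
      simp [Matrix.smul_single]
    rw [this]
    exact ContDiffAt.sum fun i _ => ContDiffAt.sum fun j _ => (h i j).smul contDiffAt_const

/-- A pseudo-orthonormal basis at a point extends to a smooth pseudo-orthonormal frame. -/
theorem exists_smooth_pseudoOrthonormal_frame {V : Type*} [NormedAddCommGroup V] [NormedSpace ℝ V]
    {G : E → V →L[ℝ] V →L[ℝ] ℝ} {u₀ : E} (hG : ∀ᶠ u in 𝓝 u₀, ContDiffAt ℝ ∞ G u)
    (hsymm : ∀ᶠ u in 𝓝 u₀, ∀ v w, G u v w = G u w v) {e : Fin 4 → V}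
    (he : ∀ i j, G u₀ (e i) (e j) = if i = j then neutralSign i else 0) :
    ∃ f : Fin 4 → E → V, ∀ᶠ u in 𝓝 u₀, (∀ i, ContDiffAt ℝ ∞ (f i) u) ∧
      ∀ i j, G u (f i u) (f j u) = if i = j then neutralSign i else 0 := by
  open scoped Matrix.Norms.Operator in
  -- Symmetric orthonormalisation: the constant basis is corrected by the inverse square root of `η`
  -- times its Gram matrix. Unlike Gram–Schmidt it treats all signs alike. The commutation condition
  -- with `1` is vacuous.
  obtain ⟨s, -, hs⟩ := exists_smooth_inverse_sqrt neutralGram 1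
  let gram : E → Matrix (Fin 4) (Fin 4) ℝ := fun u => Matrix.of fun i j => G u (e i) (e j)
  have hgram : ∀ u, ContDiffAt ℝ ∞ G u → ContDiffAt ℝ ∞ gram u := fun u hu =>
    contDiffAt_matrix_iff.2 fun i j => (hu.clm_apply contDiffAt_const).clm_apply contDiffAt_const
  let K : E → Matrix (Fin 4) (Fin 4) ℝ := fun u => neutralGram * gram u
  have hK : ∀ u, ContDiffAt ℝ ∞ G u → ContDiffAt ℝ ∞ K u := fun u hu =>
    contDiffAt_const.mul (hgram u hu)
  have hK0 : K u₀ = 1 := by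
    have : gram u₀ = neutralGram := by
      ext i j
      simp [gram, he, neutralGram, Matrix.diagonal_apply]
    rw [← neutralGram_mul_self, ← this]
    simp [K, this]
  have hKc : Filter.Tendsto K (𝓝 u₀) (𝓝 1) := by
    have := (hK u₀ hG.self_of_nhds).continuousAt
    rwa [ContinuousAt, hK0] at this
  refine ⟨fun j u => ∑ i, s (K u) i j • e i, ?_⟩
  filter_upwards [hG, hsymm, hKc.eventually hs] with u h1 h2 h3
  constructor
  · intro j
    have h4 : ContDiffAt ℝ ∞ (fun u => s (K u)) u := h3.1.comp u (hK u h1)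
    exact ContDiffAt.sum fun i _ => (contDiffAt_matrix_iff.1 h4 i j).smul contDiffAt_const
  · have hηK : neutralGram * K u = gram u := by
      simp only [K]
      rw [← mul_assoc, neutralGram_mul_self, one_mul]
    have hgt : (gram u)ᵀ = gram u := by
      ext i j
      exact h2 _ _
    have hηt : neutralGramᵀ = neutralGram := Matrix.diagonal_transpose _
    obtain ⟨f1, -, f3⟩ := h3.2 (by
      rw [hηK]
      simp only [K]
      rw [Matrix.transpose_mul, hgt, hηt, mul_assoc, neutralGram_mul_self, mul_one]) (by simp)
    have h5 : (s (K u))ᵀ * gram u * s (K u) = neutralGram := by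
      rw [← hηK, ← mul_assoc, f1, mul_assoc, mul_assoc, ← mul_assoc (s (K u)), f3, mul_one]
    intro i j
    have h6 := congrFun (congrFun h5 i) j
    rw [neutralGram, Matrix.diagonal_apply] at h6
    rw [← h6]
    simp only [Matrix.mul_apply, map_sum, map_smul, Matrix.transpose_apply,
      sum_apply, smul_apply, smul_eq_mul, gram,
      Matrix.of_apply, Finset.sum_mul, Finset.mul_sum]
    refine Finset.sum_congr rfl fun k _ => Finset.sum_congr rfl fun l _ => ?_
    ring

/-- A smooth family of matrices of Jacobi operators that are similar to each other is brought into
normal form by a smooth family of Lorentz transformations. -/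
theorem exists_smooth_normalForm {J : E → Matrix (Fin 4) (Fin 4) ℝ} {u₀ : E}
    (hJ : ∀ᶠ u in 𝓝 u₀, (∀ i j, ContDiffAt ℝ ∞ (fun u => J u i j) u) ∧
      (∀ i, J u 0 i = 0 ∧ J u i 0 = 0) ∧ IsLorentzSelfAdjoint (lowerBlock (J u)) ∧
      ∃ Q : Matrix (Fin 4) (Fin 4) ℝ, IsUnit Q ∧ J u * Q = Q * J u₀) :
    ∃ (L : Matrix (Fin 3) (Fin 3) ℝ) (M : E → Matrix (Fin 3) (Fin 3) ℝ), IsNormalForm L ∧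
      ∀ᶠ u in 𝓝 u₀, (∀ i j, ContDiffAt ℝ ∞ (fun u => M u i j) u) ∧
        (M u)ᵀ * lorentzGram * M u = lorentzGram ∧ lowerBlock (J u) * M u = M u * L := by
  open scoped Matrix.Norms.Operator in
  obtain ⟨-, hz, hsa, -⟩ := hJ.self_of_nhds
  obtain ⟨L, hL, A, hA, hTA⟩ := exists_normalForm hsa
  obtain ⟨F, hF⟩ := exists_smooth_isometric_intertwiner lorentzGram lorentzGram_mul_self
    lorentzGram_transpose (J u₀) hz hsa
  refine ⟨L, fun u => F (J u) * A, hL, ?_⟩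
  have hJ' : ∀ u, (∀ i j, ContDiffAt ℝ ∞ (fun u => J u i j) u) → ContDiffAt ℝ ∞ J u :=
    fun u h => contDiffAt_matrix_iff.2 h
  have hc : Filter.Tendsto J (𝓝 u₀) (𝓝 (J u₀)) := (hJ' u₀ hJ.self_of_nhds.1).continuousAt
  filter_upwards [hJ, hc.eventually hF] with u h1 h2
  obtain ⟨e1, e2⟩ := h2.2 h1.2.1 h1.2.2.1 h1.2.2.2
  refine ⟨contDiffAt_matrix_iff.1 ((h2.1.comp u (hJ' u h1.1)).mul contDiffAt_const), ?_, ?_⟩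
  · calc (F (J u) * A)ᵀ * lorentzGram * (F (J u) * A)
        = Aᵀ * ((F (J u))ᵀ * lorentzGram * F (J u)) * A := by
          simp only [Matrix.transpose_mul, mul_assoc]
      _ = lorentzGram := by rw [e1, hA]
  · rw [← mul_assoc, e2, mul_assoc, hTA, mul_assoc]

end SmoothFrames

/-! ### The metric and its curvature in a chart -/

section ChartExpressions

variable {M : Type*} [TopologicalSpace M] [ChartedSpace E4 M]

/-- The derivative of the inverse of a chart. -/
def symmDeriv (φ : OpenPartialHomeomorph M E4) (u : E4) :
    E4 →L[ℝ] TangentSpace 𝓘(ℝ, E4) (φ.symm u) :=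
  mfderiv 𝓘(ℝ, E4) 𝓘(ℝ, E4) φ.symm u

/-- All tangent spaces are copies of `E4`, so a vector may be moved between the propositionally
equal points `φ.symm (φ q)` and `q`. -/
theorem tangentBundle_mk_eq {p q : M} (h : p = q) (v : E4) :
    (⟨p, v⟩ : TangentBundle 𝓘(ℝ, E4) M) = ⟨q, v⟩ := by
  subst h; rfl

theorem finrank_tangentSpace (p : M) : Module.finrank ℝ (TangentSpace 𝓘(ℝ, E4) p) = 4 :=
  finrank_euclideanSpace_fin (𝕜 := ℝ) (n := 4)

variable [IsManifold 𝓘(ℝ, E4) ∞ M]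

section

variable {φ : OpenPartialHomeomorph M E4} (hφ : φ ∈ atlas E4 M) {u : E4} (hu : u ∈ φ.target)

include hφ

theorem mdifferentiable_of_mem_atlas_infty : φ.MDifferentiable 𝓘(ℝ, E4) 𝓘(ℝ, E4) := by
  have : IsManifold 𝓘(ℝ, E4) 1 M := IsManifold.of_le (n := ∞) (by simp)
  exact mdifferentiable_of_mem_atlas hφ

include hu

theorem contMDiffAt_symm_of_mem_atlas : ContMDiffAt 𝓘(ℝ, E4) 𝓘(ℝ, E4) ∞ φ.symm u :=
  (contMDiffOn_symm_of_mem_maximalAtlas (IsManifold.subset_maximalAtlas hφ)).contMDiffAt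
    (φ.open_target.mem_nhds hu)

theorem symmDeriv_bijective : Function.Bijective (symmDeriv φ u) :=
  (mdifferentiable_of_mem_atlas_infty hφ).symm.mfderiv_bijective (x := u) hu

theorem contMDiffAt_symmDeriv {v : E4 → E4} (hv : ContDiffAt ℝ ∞ v u) :
    ContMDiffAt 𝓘(ℝ, E4) 𝓘(ℝ, E4).tangent ∞
      (fun u => (⟨φ.symm u, symmDeriv φ u (v u)⟩ : TangentBundle 𝓘(ℝ, E4) M)) u := by
  have h1 : ContMDiffOn 𝓘(ℝ, E4) 𝓘(ℝ, E4) ∞ φ.symm φ.target :=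
    contMDiffOn_symm_of_mem_maximalAtlas (IsManifold.subset_maximalAtlas hφ)
  have h2 := h1.contMDiffOn_tangentMapWithin (m := ∞) (by simp) φ.open_target.uniqueMDiffOn
  have h3 : ContMDiffAt 𝓘(ℝ, E4) 𝓘(ℝ, E4).tangent ∞
      (fun u => (⟨u, v u⟩ : TangentBundle 𝓘(ℝ, E4) E4)) u :=
    contMDiffAt_vectorSpace_iff_contDiffAt.2 hv
  have h4 : IsOpen (Bundle.TotalSpace.proj ⁻¹' φ.target : Set (TangentBundle 𝓘(ℝ, E4) E4)) :=
    φ.open_target.preimage (FiberBundle.continuous_proj _ _)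
  have h5 := (h2.contMDiffAt (x := (⟨u, v u⟩ : TangentBundle 𝓘(ℝ, E4) E4))
    (h4.mem_nhds hu)).comp u h3
  refine h5.congr_of_eventuallyEq ?_
  filter_upwards [φ.open_target.mem_nhds hu] with w hw
  have h6 : mfderivWithin 𝓘(ℝ, E4) 𝓘(ℝ, E4) φ.symm φ.target w
      = mfderiv 𝓘(ℝ, E4) 𝓘(ℝ, E4) φ.symm w :=
    mfderivWithin_of_isOpen φ.open_target hw
  simp only [Function.comp_apply, tangentMapWithin, symmDeriv, h6]
  rfl

end

namespace PseudoRiemannianMetric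

variable (g : PseudoRiemannianMetric M) {φ : OpenPartialHomeomorph M E4} {u : E4}

theorem inChart_apply (v w : E4) :
    g.inChart φ u v w = g.form (φ.symm u) (symmDeriv φ u v) (symmDeriv φ u w) := rfl

theorem contDiffAt_inChart (hφ : φ ∈ atlas E4 M) (hu : u ∈ φ.target) :
    ContDiffAt ℝ ∞ (g.inChart φ) u := by
  suffices h : ContDiffOn ℝ ∞ (g.inChart φ) φ.target from
    h.contDiffAt (φ.open_target.mem_nhds hu)
  simp only [contDiffOn_clm_apply]
  intro v w u hu
  refine ContDiffAt.contDiffWithinAt ?_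
  have h1 := g.contMDiff.contMDiffAt.comp u (contMDiffAt_symm_of_mem_atlas hφ hu)
  have hv := contMDiffAt_symmDeriv hφ hu (v := fun _ => v) contDiffAt_const
  have hw := contMDiffAt_symmDeriv hφ hu (v := fun _ => w) contDiffAt_const
  have h2 := ContMDiffAt.clm_bundle_apply₂ (F₁ := E4) (F₂ := E4) (F₃ := ℝ)
    (E₁ := fun p : M => TangentSpace 𝓘(ℝ, E4) p) (E₂ := fun p : M => TangentSpace 𝓘(ℝ, E4) p)
    (E₃ := fun _ : M => ℝ) (b := φ.symm) (ψ := fun u => g.val (φ.symm u)) h1 hv hw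
  rw [Bundle.contMDiffAt_totalSpace] at h2
  exact h2.2.contDiffAt

theorem isSmoothMetricAt_inChart (hφ : φ ∈ atlas E4 M) (hu : u ∈ φ.target) :
    IsSmoothMetricAt (g.inChart φ) u where
  contDiffAt := g.contDiffAt_inChart hφ hu
  symm := Filter.Eventually.of_forall fun _ _ _ => g.symm _ _ _
  isInvertible := by
    filter_upwards [φ.open_target.mem_nhds hu] with u' hu'
    have hinj : Function.Injective (g.inChart φ u') := by
      rw [injective_iff_map_eq_zero]
      intro v hv
      apply (symmDeriv_bijective hφ hu').1
      rw [map_zero]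
      refine g.nondegenerate _ _ fun w => ?_
      obtain ⟨w, rfl⟩ := (symmDeriv_bijective hφ hu').2 w
      exact congrArg (fun L => L w) hv
    have hfin : Module.finrank ℝ E4 = Module.finrank ℝ (E4 →L[ℝ] ℝ) := by
      rw [← (LinearMap.toContinuousLinearMap (𝕜 := ℝ) (E := E4) (F' := ℝ)).finrank_eq,
        Module.finrank_linearMap_self]
    let e := LinearEquiv.ofInjectiveOfFinrankEq (g.inChart φ u' : E4 →ₗ[ℝ] E4 →L[ℝ] ℝ) hinj hfin
    exact ⟨e.toContinuousLinearEquiv, by ext; rfl⟩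

theorem contDiffAt_chart_comp_symm {χ : OpenPartialHomeomorph M E4} (hφ : φ ∈ atlas E4 M)
    (hχ : χ ∈ atlas E4 M) (hu : u ∈ φ.target) (hu' : φ.symm u ∈ χ.source) :
    ContDiffAt ℝ ∞ (χ ∘ φ.symm) u := by
  have h1 : ContMDiffAt 𝓘(ℝ, E4) 𝓘(ℝ, E4) ∞ χ (φ.symm u) :=
    (contMDiffOn_of_mem_maximalAtlas (IsManifold.subset_maximalAtlas hχ)).contMDiffAt
      (χ.open_source.mem_nhds hu')
  exact (h1.comp u (contMDiffAt_symm_of_mem_atlas hφ hu)).contDiffAt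

theorem mfderiv_symmDeriv {χ : OpenPartialHomeomorph M E4} (hφ : φ ∈ atlas E4 M)
    (hχ : χ ∈ atlas E4 M) (hu : u ∈ φ.target) (hu' : φ.symm u ∈ χ.source) (v : E4) :
    mfderiv 𝓘(ℝ, E4) 𝓘(ℝ, E4) χ (φ.symm u) (symmDeriv φ u v) =
      fderiv ℝ (χ ∘ φ.symm) u v := by
  rw [← mfderiv_eq_fderiv, mfderiv_comp u
    ((mdifferentiable_of_mem_atlas_infty hχ).mdifferentiableAt hu')
    ((mdifferentiable_of_mem_atlas_infty hφ).mdifferentiableAt_symm hu)]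
  rfl

/-- The chain rule for `φ⁻¹ = χ⁻¹ ∘ (χ ∘ φ⁻¹)`, stated in `E4` because the two base points agree
only propositionally. -/
theorem symmDeriv_eq_comp {χ : OpenPartialHomeomorph M E4} (hφ : φ ∈ atlas E4 M)
    (hχ : χ ∈ atlas E4 M) (hu : u ∈ φ.target) (hu' : φ.symm u ∈ χ.source) (v : E4) :
    (symmDeriv φ u v : E4) = (symmDeriv χ (χ (φ.symm u)) (fderiv ℝ (χ ∘ φ.symm) u v) : E4) := by
  rw [← mfderiv_symmDeriv hφ hχ hu hu']
  have h := (mdifferentiable_of_mem_atlas_infty hχ).symm_comp_deriv hu'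
  exact (congrArg (fun L => L (symmDeriv φ u v)) h).symm

theorem isMetricPullbackAt_inChart {χ : OpenPartialHomeomorph M E4} (hφ : φ ∈ atlas E4 M)
    (hχ : χ ∈ atlas E4 M) (hu : u ∈ φ.target) (hu' : φ.symm u ∈ χ.source) :
    IsMetricPullbackAt (g.inChart φ) (g.inChart χ) (χ ∘ φ.symm) u where
  contDiffAt := contDiffAt_chart_comp_symm hφ hχ hu hu'
  source := g.isSmoothMetricAt_inChart hφ hu
  target := g.isSmoothMetricAt_inChart hχ (χ.map_source hu')
  eq := by
    have hev : ∀ᶠ w in 𝓝 u, φ.symm w ∈ χ.source :=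
      (φ.symm.continuousAt hu).eventually (χ.open_source.mem_nhds hu')
    filter_upwards [φ.open_target.mem_nhds hu, hev] with w hw hw' a b
    let B : M → E4 →L[ℝ] E4 →L[ℝ] ℝ := g.val
    change B (φ.symm w) (symmDeriv φ w a : E4) (symmDeriv φ w b : E4)
      = B (χ.symm (χ (φ.symm w))) (symmDeriv χ (χ (φ.symm w)) _ : E4)
        (symmDeriv χ (χ (φ.symm w)) _ : E4)
    rw [χ.left_inv hw', symmDeriv_eq_comp hφ hχ hw hw' a, symmDeriv_eq_comp hφ hχ hw hw' b]
    rfl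

/-- The curvature tensor can be computed in any chart. -/
theorem riemannTensor_symmDeriv (hφ : φ ∈ atlas E4 M) (hu : u ∈ φ.target) (x y z v : E4) :
    g.riemannTensor (φ.symm u) (symmDeriv φ u x) (symmDeriv φ u y) (symmDeriv φ u z)
      (symmDeriv φ u v) = coordRiemann (g.inChart φ) u x y z v := by
  have hχ := chart_mem_atlas E4 (φ.symm u)
  have hs := mem_chart_source E4 (φ.symm u)
  have hev : ∀ᶠ w in 𝓝 u, φ.symm w ∈ (chartAt E4 (φ.symm u)).source :=
    (φ.symm.continuousAt hu).eventually ((chartAt E4 (φ.symm u)).open_source.mem_nhds hs)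
  have h : ∀ᶠ w in 𝓝 u, IsMetricPullbackAt (g.inChart φ) (g.inChart (chartAt E4 (φ.symm u)))
      (chartAt E4 (φ.symm u) ∘ φ.symm) w := by
    filter_upwards [φ.open_target.mem_nhds hu, hev] with w hw hw'
    exact g.isMetricPullbackAt_inChart hφ hχ hw hw'
  rw [IsMetricPullbackAt.coordRiemann_eq h]
  simp only [← mfderiv_symmDeriv hφ hχ hu hs]
  rfl

theorem isCurvatureLike_riemannTensor (p : M) : (g.riemannTensor p).IsCurvatureLike :=
  (g.isSmoothMetricAt_inChart (chart_mem_atlas E4 p)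
    (mem_chart_target E4 p)).isCurvatureLike_coordRiemann.pullback _

/-- The components of `B` are smooth functions in the chart `φ`. -/
def IsSmoothInChartAt (φ : OpenPartialHomeomorph M E4)
    (B : ∀ p : M, FourTensor (TangentSpace 𝓘(ℝ, E4) p)) (u : E4) : Prop :=
  ∀ x y z v : E4 → E4, ContDiffAt ℝ ∞ x u → ContDiffAt ℝ ∞ y u → ContDiffAt ℝ ∞ z u →
    ContDiffAt ℝ ∞ v u → ContDiffAt ℝ ∞ (fun w => B (φ.symm w) (symmDeriv φ w (x w))
      (symmDeriv φ w (y w)) (symmDeriv φ w (z w)) (symmDeriv φ w (v w))) u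

theorem isSmoothInChartAt_riemannTensor (hφ : φ ∈ atlas E4 M) (hu : u ∈ φ.target) :
    IsSmoothInChartAt φ g.riemannTensor u := by
  intro x y z v hx hy hz hv
  have h := g.isSmoothMetricAt_inChart hφ hu
  refine ContDiffAt.congr_of_eventuallyEq
    ((h.contDiffAt.clm_apply (h.contDiffAt_coordCurvature hx hy hz)).clm_apply hv) ?_
  filter_upwards [φ.open_target.mem_nhds hu] with w hw
  rw [g.riemannTensor_symmDeriv hφ hw, coordRiemann_apply]

/-- The Weyl tensor at `p`. -/
def weylTensorAt (p : M) : FourTensor (TangentSpace 𝓘(ℝ, E4) p) :=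
  weylTensor (g.form p) (g.form_nondegenerate p) (g.riemannTensor p)

theorem isCurvatureLike_weylTensorAt (hg : g.IsNeutral) (p : M) :
    (g.weylTensorAt p).IsCurvatureLike := by
  obtain ⟨b, hb⟩ := hg p
  exact isCurvatureLike_weylTensor _ (g.symm p) hb (g.isCurvatureLike_riemannTensor p)

/-- `f` is a pseudo-orthonormal frame in the chart `φ`, smooth at `u`. -/
def IsFrameInChartAt (φ : OpenPartialHomeomorph M E4) (f : Fin 4 → E4 → E4) (u : E4) : Prop :=
  (∀ i, ContDiffAt ℝ ∞ (f i) u) ∧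
    IsPseudoOrthonormal (g.form (φ.symm u)) fun i => symmDeriv φ u (f i u)

theorem exists_isFrameInChartAt (hg : g.IsNeutral) (hφ : φ ∈ atlas E4 M) (hu : u ∈ φ.target) :
    ∃ f : Fin 4 → E4 → E4, ∀ᶠ w in 𝓝 u, g.IsFrameInChartAt φ f w := by
  obtain ⟨b, hb⟩ := hg (φ.symm u)
  choose e he using fun i => (symmDeriv_bijective hφ hu).2 (b i)
  obtain ⟨f, hf⟩ := exists_smooth_pseudoOrthonormal_frame (G := g.inChart φ) (u₀ := u) (e := e)
    (by filter_upwards [φ.open_target.mem_nhds hu] with w hw using g.contDiffAt_inChart hφ hw)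
    (g.isSmoothMetricAt_inChart hφ hu).symm
    (fun i j => by rw [inChart_apply, he, he]; exact hb i j)
  refine ⟨f, ?_⟩
  filter_upwards [hf] with w hw using ⟨hw.1, fun i j => hw.2 i j⟩

theorem metricContraction_form_eq_sum {p : M} {e : Fin 4 → TangentSpace 𝓘(ℝ, E4) p}
    (he : IsPseudoOrthonormal (g.form p) e) (h : LinearMap.BilinForm ℝ (TangentSpace 𝓘(ℝ, E4) p)) :
    metricContraction (g.form p) (g.form_nondegenerate p) h =
      ∑ i, neutralSign i * h (e i) (e i) := by
  obtain ⟨b, rfl⟩ := he.exists_basis (finrank_tangentSpace p)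
  exact metricContraction_eq_sum _ _ _ b he

/-- The Ricci tensor and the scalar curvature become finite sums of smooth functions once the
contractions are written in a smooth pseudo-orthonormal frame. -/
theorem isSmoothInChartAt_weylTensorAt (hg : g.IsNeutral) (hφ : φ ∈ atlas E4 M)
    (hu : u ∈ φ.target) : IsSmoothInChartAt φ g.weylTensorAt u := by
  obtain ⟨f, hf⟩ := g.exists_isFrameInChartAt hg hφ hu
  have hR := g.isSmoothInChartAt_riemannTensor hφ hu
  have hf1 := hf.self_of_nhds.1
  let ric : ∀ p : M, LinearMap.BilinForm ℝ (TangentSpace 𝓘(ℝ, E4) p) := fun p =>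
    ricciTensor (g.form p) (g.form_nondegenerate p) (g.riemannTensor p)
  have hform : ∀ x y : E4 → E4, ContDiffAt ℝ ∞ x u → ContDiffAt ℝ ∞ y u →
      ContDiffAt ℝ ∞ (fun w => g.form (φ.symm w) (symmDeriv φ w (x w)) (symmDeriv φ w (y w))) u :=
    fun x y hx hy => ((g.contDiffAt_inChart hφ hu).clm_apply hx).clm_apply hy
  have hric : ∀ x y : E4 → E4, ContDiffAt ℝ ∞ x u → ContDiffAt ℝ ∞ y u →
      ContDiffAt ℝ ∞ (fun w => ric (φ.symm w) (symmDeriv φ w (x w)) (symmDeriv φ w (y w))) u := by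
    intro x y hx hy
    have h1 : ContDiffAt ℝ ∞ (fun w => ∑ i, neutralSign i * g.riemannTensor (φ.symm w)
        (symmDeriv φ w (f i w)) (symmDeriv φ w (x w)) (symmDeriv φ w (f i w))
        (symmDeriv φ w (y w))) u :=
      ContDiffAt.sum fun i _ => contDiffAt_const.mul (hR _ _ _ _ (hf1 i) hx (hf1 i) hy)
    refine h1.congr_of_eventuallyEq ?_
    filter_upwards [hf] with w hw
    simp only [ric, ricciTensor_apply, g.metricContraction_form_eq_sum hw.2, slotsOneThree_apply]
  have hscal : ContDiffAt ℝ ∞ (fun w => scalarCurvature (g.form (φ.symm w))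
      (g.form_nondegenerate _) (g.riemannTensor (φ.symm w))) u := by
    have h1 : ContDiffAt ℝ ∞ (fun w => ∑ i, neutralSign i * ric (φ.symm w)
        (symmDeriv φ w (f i w)) (symmDeriv φ w (f i w))) u :=
      ContDiffAt.sum fun i _ => contDiffAt_const.mul (hric _ _ (hf1 i) (hf1 i))
    refine h1.congr_of_eventuallyEq ?_
    filter_upwards [hf] with w hw
    rw [scalarCurvature, g.metricContraction_form_eq_sum hw.2]
  intro x y z v hx hy hz hv
  have htf : ∀ a b : E4 → E4, ContDiffAt ℝ ∞ a u → ContDiffAt ℝ ∞ b u →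
      ContDiffAt ℝ ∞ (fun w => (ric (φ.symm w) - (scalarCurvature (g.form (φ.symm w))
        (g.form_nondegenerate _) (g.riemannTensor (φ.symm w)) / 4) • g.form (φ.symm w))
        (symmDeriv φ w (a w)) (symmDeriv φ w (b w))) u := fun a b ha hb =>
    (hric a b ha hb).sub ((hscal.div_const 4).mul (hform a b ha hb))
  have hkn : ∀ h k : ∀ p : M, LinearMap.BilinForm ℝ (TangentSpace 𝓘(ℝ, E4) p),
      (∀ a b : E4 → E4, ContDiffAt ℝ ∞ a u → ContDiffAt ℝ ∞ b u → ContDiffAt ℝ ∞ (fun w =>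
        h (φ.symm w) (symmDeriv φ w (a w)) (symmDeriv φ w (b w))) u) →
      (∀ a b : E4 → E4, ContDiffAt ℝ ∞ a u → ContDiffAt ℝ ∞ b u → ContDiffAt ℝ ∞ (fun w =>
        k (φ.symm w) (symmDeriv φ w (a w)) (symmDeriv φ w (b w))) u) →
      ContDiffAt ℝ ∞ (fun w => kulkarniNomizu (h (φ.symm w)) (k (φ.symm w))
        (symmDeriv φ w (x w)) (symmDeriv φ w (y w)) (symmDeriv φ w (z w))
        (symmDeriv φ w (v w))) u := by
    intro h k hh hk
    simp only [kulkarniNomizu_apply]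
    exact ((((hh x z hx hz).mul (hk y v hy hv)).add ((hh y v hy hv).mul (hk x z hx hz))).sub
      ((hh x v hx hv).mul (hk y z hy hz))).sub ((hh y z hy hz).mul (hk x v hx hv))
  exact ((hR x y z v hx hy hz hv).sub ((hscal.div_const 24).mul
    (hkn (fun p => g.form p) (fun p => g.form p) hform hform))).sub
    (contDiffAt_const.mul (hkn (fun p => ric p - (scalarCurvature (g.form p)
      (g.form_nondegenerate p) (g.riemannTensor p) / 4) • g.form p) (fun p => g.form p) htf hform))

/-- If the Jacobi operators of a curvature-like tensor field have the same Jordan normal form, then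
there are local frames in which their matrix is constant and of one of the four types. -/
theorem exists_frame_of_jordanOsserman (hg : g.IsNeutral)
    {B : ∀ p : M, FourTensor (TangentSpace 𝓘(ℝ, E4) p)} (hB : ∀ p, (B p).IsCurvatureLike)
    (hsmooth : ∀ φ ∈ atlas E4 M, ∀ u ∈ φ.target, IsSmoothInChartAt φ B u)
    {N : Matrix (Fin 4) (Fin 4) ℂ}
    (hN : ∀ (p : M) (x : TangentSpace 𝓘(ℝ, E4) p), g.form p x x = -1 →
      HasJordanNormalForm (jacobiOperator (g.form p) (g.form_nondegenerate p) (B p) x) N) (P : M) :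
    ∃ (U : Set M) (e : Fin 4 → ∀ p : M, TangentSpace 𝓘(ℝ, E4) p) (L : Matrix (Fin 3) (Fin 3) ℝ),
      IsOpen U ∧ P ∈ U ∧ g.IsSmoothFrameOn e U ∧ IsNormalForm L ∧
      ∀ Q ∈ U, IsMatrixOnLastThree
        (jacobiOperator (g.form Q) (g.form_nondegenerate Q) (B Q) (e 0 Q)) (fun i => e i Q) L := by
  set φ := chartAt E4 P
  have hφ : φ ∈ atlas E4 M := chart_mem_atlas E4 P
  have hP : P ∈ φ.source := mem_chart_source E4 P
  have hu : φ P ∈ φ.target := φ.map_source hP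
  obtain ⟨f, hf⟩ := g.exists_isFrameInChartAt hg hφ hu
  let J : E4 → Matrix (Fin 4) (Fin 4) ℝ := fun w =>
    jacobiMatrix (B (φ.symm w)) fun i => symmDeriv φ w (f i w)
  -- The first frame vector is unit timelike, so the Jordan hypothesis applies to the operator whose
  -- matrix is `J w`.
  have hsim : ∀ w, g.IsFrameInChartAt φ f w →
      ∃ b : Module.Basis (Fin 4) ℝ (TangentSpace 𝓘(ℝ, E4) (φ.symm w)),
        (⇑b = fun i => symmDeriv φ w (f i w)) ∧
        LinearMap.toMatrix b b (jacobiOperator (g.form (φ.symm w)) (g.form_nondegenerate _)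
          (B (φ.symm w)) (b 0)) = J w ∧
        HasJordanNormalForm (jacobiOperator (g.form (φ.symm w)) (g.form_nondegenerate _)
          (B (φ.symm w)) (b 0)) N := by
    intro w hw
    obtain ⟨b, hb⟩ := hw.2.exists_basis (finrank_tangentSpace _)
    have hb' : IsPseudoOrthonormal (g.form (φ.symm w)) b := hb ▸ hw.2
    refine ⟨b, hb, ?_, hN _ _ ?_⟩
    · rw [toMatrix_jacobiOperator _ _ hb', hb]
    · rw [hb' 0 0]
      simp [neutralSign]
  obtain ⟨L, A, hL, hA⟩ := exists_smooth_normalForm (J := J) (u₀ := φ P) (by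
    filter_upwards [hf, φ.open_target.mem_nhds hu] with w hw hw'
    refine ⟨fun i j => contDiffAt_const.mul (hsmooth φ hφ w hw' _ _ _ _ (hw.1 j) (hw.1 0) (hw.1 0)
      (hw.1 i)), (hB _).jacobiMatrix_zero _, (hB _).isLorentzSelfAdjoint _, ?_⟩
    obtain ⟨b, -, hb, hbN⟩ := hsim w hw
    obtain ⟨b', -, hb', hbN'⟩ := hsim _ hf.self_of_nhds
    rw [← hb, ← hb']
    exact hbN.exists_intertwiner hbN' b b')
  -- Only the last three vectors change, so the Jacobi operator of the first is the same before and
  -- after.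
  let h : Fin 4 → E4 → E4 := fun i w => changeLastThree (A w) (fun i => f i w) i
  obtain ⟨O, hO, hOo, hPO⟩ := eventually_nhds_iff.1 ((hf.and hA).and (φ.open_target.mem_nhds hu))
  have hh : ∀ w ∈ O, ∀ i, ContDiffAt ℝ ∞ (h i) w := by
    intro w hw i
    obtain ⟨⟨h1, h2, -⟩, -⟩ := hO w hw
    refine Fin.cases ?_ (fun i => ?_) i
    · exact h1.1 0
    · have h3 : ContDiffAt ℝ ∞ (fun w => ∑ k, A w k i • f k.succ w) w :=
        ContDiffAt.sum fun k _ => (h2 k i).smul (h1.1 k.succ)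
      exact h3
  have hD : ∀ w, (fun i => symmDeriv φ w (h i w)) =
      changeLastThree (A w) fun i => symmDeriv φ w (f i w) := by
    intro w
    funext i
    refine Fin.cases ?_ (fun i => ?_) i
    · rfl
    · simp [h, changeLastThree]
  have key : ∀ w ∈ O, IsPseudoOrthonormal (g.form (φ.symm w)) (fun i => symmDeriv φ w (h i w)) ∧
      IsMatrixOnLastThree (jacobiOperator (g.form (φ.symm w)) (g.form_nondegenerate _)
        (B (φ.symm w)) (symmDeriv φ w (h 0 w))) (fun i => symmDeriv φ w (h i w)) L := by
    intro w hw
    obtain ⟨⟨h1, -, h3, h4⟩, -⟩ := hO w hw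
    rw [hD]
    refine ⟨h1.2.changeLastThree h3, ?_⟩
    obtain ⟨b, hb, hb1, -⟩ := hsim w h1
    have hb0 : b 0 = symmDeriv φ w (h 0 w) := by rw [hb]; rfl
    rw [hb0] at hb1
    rw [← hb]
    exact isMatrixOnLastThree_changeLastThree hb1
      (fun i => ((hB _).jacobiMatrix_zero _ i).1) h4
  -- The frame is built at `φ.symm (φ Q)`; regarding its vectors as elements of `E4` lets its
  -- properties be carried to `Q`.
  have transport : ∀ (p q : M) (_ : p = q) (e : Fin 4 → E4),
      IsPseudoOrthonormal (g.form p) e ∧ IsMatrixOnLastThree (jacobiOperator (g.form p)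
        (g.form_nondegenerate p) (B p) (e 0)) e L →
      IsPseudoOrthonormal (g.form q) e ∧ IsMatrixOnLastThree (jacobiOperator (g.form q)
        (g.form_nondegenerate q) (B q) (e 0)) e L := by
    rintro p _ rfl e he
    exact he
  have key' : ∀ Q ∈ φ.source ∩ φ ⁻¹' O, _ := fun Q hQ =>
    transport (φ.symm (φ Q)) Q (φ.left_inv hQ.1) (fun i => symmDeriv φ (φ Q) (h i (φ Q)))
      (key (φ Q) hQ.2)
  refine ⟨φ.source ∩ φ ⁻¹' O, fun i p => (symmDeriv φ (φ p) (h i (φ p)) : E4), L,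
    φ.isOpen_inter_preimage hOo, ⟨hP, hPO⟩, ⟨fun i Q hQ => ?_, fun Q hQ => (key' Q hQ).1⟩, hL,
    fun Q hQ => (key' Q hQ).2⟩
  have h1 := contMDiffAt_symmDeriv hφ (φ.map_source hQ.1) (hh (φ Q) hQ.2 i)
  have h2 : ContMDiffAt 𝓘(ℝ, E4) 𝓘(ℝ, E4) ∞ φ Q :=
    (contMDiffOn_of_mem_maximalAtlas (IsManifold.subset_maximalAtlas hφ)).contMDiffAt
      (φ.open_source.mem_nhds hQ.1)
  refine ((h1.comp Q h2).congr_of_eventuallyEq ?_).contMDiffWithinAt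
  filter_upwards [φ.open_source.mem_nhds hQ.1] with q hq
  exact (tangentBundle_mk_eq (φ.left_inv hq) _).symm

end PseudoRiemannianMetric

end ChartExpressions

end

theorem mainTheorem6 {M : Type*} [TopologicalSpace M] [ChartedSpace E4 M]
    [IsManifold 𝓘(ℝ, E4) ∞ M] (g : PseudoRiemannianMetric M) (hg : g.IsNeutral) :
    (g.IsGloballyJordanOsserman →
      ∀ P : M, ∃ (U : Set M) (e : Fin 4 → ∀ p : M, TangentSpace 𝓘(ℝ, E4) p)
        (L : Matrix (Fin 3) (Fin 3) ℝ),
        IsOpen U ∧ P ∈ U ∧ g.IsSmoothFrameOn e U ∧ IsNormalForm L ∧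
        ∀ Q ∈ U, IsMatrixOnLastThree (g.jacobi Q (e 0 Q)) (fun i => e i Q) L) ∧
    (g.IsGloballyConformallyJordanOsserman →
      ∀ P : M, ∃ (U : Set M) (e : Fin 4 → ∀ p : M, TangentSpace 𝓘(ℝ, E4) p)
        (L : Matrix (Fin 3) (Fin 3) ℝ),
        IsOpen U ∧ P ∈ U ∧ g.IsSmoothFrameOn e U ∧ IsNormalForm L ∧
        ∀ Q ∈ U, IsMatrixOnLastThree (g.conformalJacobi Q (e 0 Q)) (fun i => e i Q) L) := by
  constructor
  · rintro ⟨N, hN⟩ P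
    exact g.exists_frame_of_jordanOsserman hg g.isCurvatureLike_riemannTensor
      (fun φ hφ u hu => g.isSmoothInChartAt_riemannTensor hφ hu) hN P
  · rintro ⟨N, hN⟩ P
    exact g.exists_frame_of_jordanOsserman hg (g.isCurvatureLike_weylTensorAt hg)
      (fun φ hφ u hu => g.isSmoothInChartAt_weylTensorAt hg hφ hu) hN P
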